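/- Let $D$ be a measurable space and let $\Psi$ be a Markov transition kernel on $D$ with invariant probability $\psi$. Write $\Psi g(x)=\int\Psi(x,dy)\,g(y)$, $\psi(g)=\int g\,d\psi$ and $\pi\Psi(A)=\int\pi(dx)\,\Psi(x,A)$. Assume that the whole state space is petite: there are a probability $\rho$ on $\mathbb N^*=\{1,2,\dots\}$ and a non-zero measure $\nu_\rho$ on $D$ such that, for every measurable $A\subseteq D$, $$\inf_{x\in D}\ \sum_{k=1}^\infty \rho(k)\,\Psi^k(x,A)\ \ge\ \nu_\rho(A).$$ Let $h_n:D\to\mathbb R$ ($n\in\mathbb N^*$) be measurable functions, integrable with respect to $\Psi(x,\cdot)$ for every $x\in D$, such that $(\Psi h_n)_{n\in\mathbb N^*}$ is uniformly bounded, that is, $\sup_{n}\sup_{x\in D}|\Psi h_n(x)|<\infty$. Let $\xi_n>0$ and $c\in\mathbb R$ be such that, as $n\to\infty$, $$n\xi_n\to\infty,\qquad \xi_n^{-1}\psi(h_n)\to c,\qquad (n\xi_n^2)^{-1}\psi(|h_n|)\to0,\qquad (n\xi_n^2)^{-1}\psi(h_n^2)\to0 .$$ For a probability $\pi$ on $D$,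 let $Z=(Z_k)_{k\ge0}$ be, under $\mathbb P^\pi$, a Markov chain with transition kernel $\Psi$ and with $Z_0$ distributed according to $\pi$, and put $$G^n_s:=\frac1{n\xi_n}\sum_{k=1}^{\lfloor sn\rfloor}h_n(Z_k),\qquad s\ge0 .$$ Then $G^n_s\to cs$ uniformly on compacts in probability under $\mathbb P^\pi$, that is, $\sup_{0\le s\le T}|G^n_s-cs|\to0$ in $\mathbb P^\pi$-probability for every $T\ge0$: (i) for every probability $\pi$ on $D$ such that $\pi\Psi$ is absolutely continuous with respect to $\psi$ (in particular for $\pi=\psi$); (ii) for every probability $\pi$ on $D$ whatsoever, if moreover $\sup_n\Psi|h_n|(x)<\infty$ for each $x\in D$ (which is automatic if the $h_n$ are non-negative, or if they are uniformly bounded). -/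

import Mathlib

open MeasureTheory ProbabilityTheory Filter Topology
open scoped ENNReal

/-- The whole state space is petite for the kernel `Ψ`: for some probability `ρ` on the positive
integers and some non-zero measure `ν`, the kernel `∑ k, ρ k • Ψ ^ k` is, at every point, bounded
below by `ν`. Powers of a kernel are taken for the composition of kernels. -/
def IsPetiteSpace {D : Type*} [MeasurableSpace D] (Ψ : Kernel D D) : Prop :=
  ∃ (ρ : PMF ℕ+) (ν : Measure D), ν ≠ 0 ∧
    ∀ A : Set D, MeasurableSet A → ν A ≤ ⨅ x : D, ∑' k : ℕ+, ρ k * (Ψ ^ (k : ℕ)) x A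

/-- The σ-algebra generated by `Z 0, …, Z k`. -/
abbrev pastSigma {Ω D : Type*} [MeasurableSpace D] (Z : ℕ → Ω → D) (k : ℕ) : MeasurableSpace Ω :=
  ⨆ j ∈ Finset.range (k + 1), MeasurableSpace.comap (Z j) inferInstance

/-- Under `P`, the sequence `Z 0, Z 1, …` is a time-homogeneous Markov chain with transition
kernel `Ψ`, and `π` is the law of `Z 0`. -/
structure IsMarkovChain {Ω D : Type*} [MeasurableSpace Ω] [MeasurableSpace D]
    (Ψ : Kernel D D) (π : Measure D) (P : Measure Ω) (Z : ℕ → Ω → D) : Prop where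
  measurable : ∀ k, Measurable (Z k)
  map_zero : P.map (Z 0) = π
  markov : ∀ (k : ℕ) (A : Set D), MeasurableSet A →
    P[(Z (k + 1) ⁻¹' A).indicator (fun _ => (1 : ℝ)) | pastSigma Z k]
      =ᵐ[P] fun ω => (Ψ (Z k ω)).real A

/-- The process `G n` (time parameter `s ≥ 0`) converges to the deterministic function `g`,
uniformly on compacts in probability. -/
def TendstoUCP {Ω : Type*} [MeasurableSpace Ω] (P : Measure Ω)
    (G : ℕ → ℝ → Ω → ℝ) (g : ℝ → ℝ) : Prop :=
  ∀ T : ℝ, 0 ≤ T → ∀ ε : ℝ, 0 < ε →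
    Tendsto (fun n => P {ω | ENNReal.ofReal ε ≤ ⨆ s ∈ Set.Icc (0 : ℝ) T,
      ENNReal.ofReal |G n s ω - g s|}) atTop (𝓝 0)

/-- The rescaled additive functional `(n ξ_n)⁻¹ ∑_{1 ≤ k ≤ ⌊s n⌋} h_n (Z_k)`. -/
noncomputable def scaledSum {Ω D : Type*} (h : ℕ → D → ℝ) (ξ : ℕ → ℝ) (Z : ℕ → Ω → D)
    (n : ℕ) (s : ℝ) (ω : Ω) : ℝ :=
  (n * ξ n)⁻¹ * ∑ k ∈ Finset.Icc 1 ⌊s * n⌋₊, h n (Z k ω)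

/-!
The proof is a second-moment argument around a Poisson equation, and the point that needs care is
that `n ξ_n²` is not assumed to tend to infinity: variances have to be controlled by `ψ(|h_n|)` and
`ψ(h_n²)`, never by a constant.

*Poisson equation.* The minorization `ν ≤ ∑ k, ρ k Ψ ^ k` makes `∑ k, ρ k Ψ ^ k - ν(·) 1` a strict
contraction for the supremum norm. The probability `ρ` may have an infinite mean, but a finite
truncation of the sum, with the missing mass put on the identity, is still a strict contraction `V`,
and `1 - V = (1 - Ψ) S + ν(·) 1` with `S` a bounded operator. Inverting `1 - V` and integrating
against the invariant probability solves `F - Ψ F = g` for every bounded `g` of mean zero, with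
`sup |F| ≤ A sup |g|` (`IsPetiteSpace.exists_hasPoissonBound`). No aperiodicity is involved.

*Variance.* With `F` the solution for `g = Ψ h - ψ(h)`, the function
`u (x, y) = h y + F y - F x - ψ(h)` is centred under `Ψ x`, and the sums of `h - ψ(h)` and of `u`
along the chain differ by boundary terms bounded by `2 sup |F|`. As
`ψ(F²) - ψ((Ψ F)²) = ψ((F - Ψ F) (F + Ψ F))`, the variance of `u` under `ψ` is at most a multiple of
`ψ(h²) + ψ(|h|)` (`memLp_poisson_increment`); no bound on `F` other than the supremum is needed.
Doob's inequality then gives uniform convergence in probability for the stationary chain.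

*Initial law.* If an event `Z k₀ ∈ B` gives `Z k₀` a (defective) law dominated by `L • ψ`, the same
domination holds at every later time, so the estimate above is valid on that event up to the factor
`L`; the first `k₀` terms are negligible one by one
(`IsMarkovChain.tendstoUCP_of_forall_exists_restrict`). If `π Ψ ≪ ψ`, the choice `k₀ = 1` is
possible. In general, the singular parts of all the laws of the `Z k` are carried by one `ψ`-null
set `N`, and the Poisson equation for the indicator of `N` shows that the expected number of visits
to `N` is finite (`IsMarkovChain.tendsto_map_apply_of_null`), so that the singular part of the law
of `Z k` has small mass for a suitable `k = k₀`.
-/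

/-! ### Bounded measurable functions and the action of a kernel -/

/-- The bounded measurable real functions on `D`, as a subspace of `ℓ^∞(D)`; the norm is the
supremum norm, with no identification of functions that agree almost everywhere. -/
def boundedMeasurableSubmodule (D : Type*) [MeasurableSpace D] :
    Submodule ℝ (lp (fun _ : D => ℝ) ∞) where
  carrier := {f | Measurable (f : D → ℝ)}
  add_mem' {f g} hf hg := Measurable.add (f := (f : D → ℝ)) (g := (g : D → ℝ)) hf hg
  zero_mem' := measurable_const (a := (0 : ℝ))
  smul_mem' c f hf := Measurable.const_smul (g := (f : D → ℝ)) hf c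

theorem isClosed_boundedMeasurableSubmodule (D : Type*) [MeasurableSpace D] :
    IsClosed (boundedMeasurableSubmodule D : Set (lp (fun _ : D => ℝ) ∞)) := by
  refine IsSeqClosed.isClosed fun u f hu hf => ?_
  refine measurable_of_tendsto_metrizable (f := fun n => ((u n : lp (fun _ : D => ℝ) ∞) : D → ℝ))
    (fun n => hu n) (tendsto_pi_nhds.2 fun x => ?_)
  rw [tendsto_iff_norm_sub_tendsto_zero] at hf ⊢
  refine squeeze_zero (fun _ => norm_nonneg _) (fun n => ?_) hf
  have := lp.norm_apply_le_norm ENNReal.top_ne_zero (u n - f) x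
  simpa [lp.coeFn_sub] using this

/-- The Banach space of bounded measurable real functions on `D`, with the supremum norm. -/
def BoundedMeasurable (D : Type*) [MeasurableSpace D] : Type _ :=
  boundedMeasurableSubmodule D

namespace BoundedMeasurable

variable {D : Type*} [MeasurableSpace D]

noncomputable instance : NormedAddCommGroup (BoundedMeasurable D) :=
  inferInstanceAs (NormedAddCommGroup (boundedMeasurableSubmodule D))

noncomputable instance : NormedSpace ℝ (BoundedMeasurable D) :=
  inferInstanceAs (NormedSpace ℝ (boundedMeasurableSubmodule D))

instance : CompleteSpace (BoundedMeasurable D) :=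
  (isClosed_boundedMeasurableSubmodule D).completeSpace_coe

/-- The underlying function. -/
def toFun (f : BoundedMeasurable D) : D → ℝ := f.1.1

instance : CoeFun (BoundedMeasurable D) (fun _ => D → ℝ) := ⟨toFun⟩

theorem measurable (f : BoundedMeasurable D) : Measurable (f : D → ℝ) := f.2

theorem abs_apply_le (f : BoundedMeasurable D) (x : D) : |f x| ≤ ‖f‖ := by
  have h : ‖(f.1 : lp (fun _ : D => ℝ) ∞) x‖ ≤ ‖f.1‖ :=
    lp.norm_apply_le_norm ENNReal.top_ne_zero _ x
  exact h

theorem integrable (f : BoundedMeasurable D) (μ : Measure D) [IsFiniteMeasure μ] :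
    Integrable (f : D → ℝ) μ :=
  Integrable.of_bound f.measurable.aestronglyMeasurable ‖f‖ (ae_of_all _ f.abs_apply_le)

/-- A measurable function bounded by `b`, as a point of `BoundedMeasurable D`. -/
noncomputable def mk (g : D → ℝ) (hg : Measurable g) (b : ℝ) (hb : ∀ x, |g x| ≤ b) :
    BoundedMeasurable D :=
  ⟨⟨g, memℓp_infty ⟨b, by rintro _ ⟨x, rfl⟩; exact hb x⟩⟩, hg⟩

theorem norm_le (f : BoundedMeasurable D) {b : ℝ} (hb0 : 0 ≤ b) (hb : ∀ x, |f x| ≤ b) :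
    ‖f‖ ≤ b :=
  lp.norm_le_of_forall_le hb0 hb

@[ext]
theorem ext {f g : BoundedMeasurable D} (h : ∀ x, f x = g x) : f = g :=
  Subtype.ext (lp.ext (funext h))

theorem abs_integral_le (f : BoundedMeasurable D) (μ : Measure D) [IsFiniteMeasure μ] :
    |∫ y, f y ∂μ| ≤ ‖f‖ * μ.real Set.univ :=
  norm_integral_le_of_norm_le_const (f := (f : D → ℝ)) (ae_of_all _ f.abs_apply_le)

/-- The operator `g ↦ Ψ g` on bounded measurable functions. -/
noncomputable def kernelOp (Ψ : Kernel D D) [IsMarkovKernel Ψ] :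
    BoundedMeasurable D →L[ℝ] BoundedMeasurable D :=
  LinearMap.mkContinuous
    { toFun := fun f => mk (fun x => ∫ y, f y ∂(Ψ x))
        (f.measurable.stronglyMeasurable.integral_kernel.measurable) ‖f‖
        (fun x => by simpa using f.abs_integral_le (Ψ x))
      map_add' := fun f g => by
        ext x
        exact integral_add (f.integrable (Ψ x)) (g.integrable (Ψ x))
      map_smul' := fun c f => by
        ext x
        exact integral_const_mul c (f : D → ℝ) }
    1 (fun f => by
      rw [one_mul]
      exact norm_le _ (norm_nonneg _) fun x => by
        refine (f.abs_integral_le (Ψ x)).trans_eq ?_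
        rw [probReal_univ, mul_one])

theorem kernelOp_apply (Ψ : Kernel D D) [IsMarkovKernel Ψ] (f : BoundedMeasurable D) (x : D) :
    kernelOp Ψ f x = ∫ y, f y ∂(Ψ x) := rfl

/-- The rank-one operator `f ↦ ν(f) 1`. -/
noncomputable def meanOp (ν : Measure D) [IsFiniteMeasure ν] :
    BoundedMeasurable D →L[ℝ] BoundedMeasurable D :=
  LinearMap.mkContinuous
    { toFun := fun f => mk (fun _ => ∫ y, f y ∂ν) measurable_const _ (fun _ => le_rfl)
      map_add' := fun f g => by
        ext x
        exact integral_add (f.integrable ν) (g.integrable ν)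
      map_smul' := fun c f => by
        ext x
        exact integral_const_mul c (f : D → ℝ) }
    (ν.real Set.univ) (fun f => by
      refine norm_le _ (by positivity) fun x => ?_
      rw [mul_comm]
      exact f.abs_integral_le ν)

theorem meanOp_apply (ν : Measure D) [IsFiniteMeasure ν] (f : BoundedMeasurable D) (x : D) :
    meanOp ν f x = ∫ y, f y ∂ν := rfl

theorem coe_add (f g : BoundedMeasurable D) (x : D) : (f + g) x = f x + g x := rfl

theorem coe_sub (f g : BoundedMeasurable D) (x : D) : (f - g) x = f x - g x := rfl

theorem coe_sum {ι : Type*} (s : Finset ι) (f : ι → BoundedMeasurable D) (x : D) :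
    (∑ i ∈ s, f i) x = ∑ i ∈ s, (f i) x := by
  classical
  induction s using Finset.induction_on with
  | empty => rfl
  | insert a s ha ih => rw [Finset.sum_insert ha, Finset.sum_insert ha, coe_add, ih]


theorem isMarkovKernel_pow {D : Type*} [MeasurableSpace D] (Ψ : Kernel D D) [IsMarkovKernel Ψ]
    (k : ℕ) : IsMarkovKernel (Ψ ^ k) := by
  induction k with
  | zero => rw [pow_zero]; exact inferInstanceAs (IsMarkovKernel Kernel.id)
  | succ k ih => rw [pow_succ]; exact inferInstanceAs (IsMarkovKernel ((Ψ ^ k) ∘ₖ Ψ))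

theorem kernelOp_pow_apply (Ψ : Kernel D D)
    [IsMarkovKernel Ψ] (f : BoundedMeasurable D) (k : ℕ) (x : D) :
    ((kernelOp Ψ ^ k) f) x = ∫ y, f y ∂((Ψ ^ k) x) := by
  induction k generalizing x with
  | zero =>
    rw [pow_zero, pow_zero]
    change f x = ∫ y, f y ∂(Measure.dirac x)
    rw [integral_dirac' _ _ f.measurable.stronglyMeasurable]
  | succ k ih =>
    have := isMarkovKernel_pow Ψ k
    rw [pow_succ', pow_succ]
    change kernelOp Ψ ((kernelOp Ψ ^ k) f) x = _
    rw [kernelOp_apply]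
    change _ = ∫ y, f y ∂(((Ψ ^ k) ∘ₖ Ψ) x)
    rw [Kernel.integral_comp (f.integrable _)]
    simp_rw [ih]

theorem abs_integral_sub_integral_le_of_le {D : Type*} [MeasurableSpace D] {μ ν : Measure D}
    [IsFiniteMeasure μ] [IsFiniteMeasure ν] (h : ν ≤ μ) (f : BoundedMeasurable D) :
    |∫ y, f y ∂μ - ∫ y, f y ∂ν| ≤ ‖f‖ * (μ.real Set.univ - ν.real Set.univ) := by
  have hμ : μ - ν + ν = μ := Measure.sub_add_cancel_of_le h
  have h1 : ∫ y, f y ∂μ = ∫ y, f y ∂(μ - ν) + ∫ y, f y ∂ν := by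
    rw [← integral_add_measure (f.integrable _) (f.integrable _), hμ]
  have h2 : μ.real Set.univ = (μ - ν).real Set.univ + ν.real Set.univ := by
    rw [← measureReal_add_apply, hμ]
  rw [h1, h2, add_sub_cancel_right, add_sub_cancel_right]
  exact f.abs_integral_le _

end BoundedMeasurable

/-! ### The Poisson equation on a petite space -/

open BoundedMeasurable in
/-- A minorization `ν ≤ ∑ k, ρ k Ψ ^ k` makes a truncated, recentred version of the operator
`∑ k, ρ k Ψ ^ k` a strict contraction for the supremum norm. -/
theorem exists_norm_truncated_lt_one {D : Type*} [MeasurableSpace D] [Nonempty D] (Ψ : Kernel D D)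
    [IsMarkovKernel Ψ] (ρ : PMF ℕ+) (ν : Measure D) (hν0 : ν ≠ 0) [IsFiniteMeasure ν]
    (hν : ∀ x, ν ≤ Measure.sum fun k : ℕ+ => ρ k • (Ψ ^ (k : ℕ)) x) :
    ∃ s : Finset ℕ+, ‖∑ k ∈ s, (ρ k).toReal • kernelOp Ψ ^ (k : ℕ)
      + (1 - ∑ k ∈ s, (ρ k).toReal) • (1 : BoundedMeasurable D →L[ℝ] BoundedMeasurable D)
      - meanOp ν‖ < 1 := by
  have hmk := isMarkovKernel_pow Ψ
  have hsum : HasSum (fun k => (ρ k).toReal) 1 := by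
    have := ENNReal.hasSum_toReal (f := fun k => ρ k) (by rw [ρ.tsum_coe]; simp)
    rwa [← ENNReal.tsum_toReal_eq (fun k => ρ.apply_ne_top k), ρ.tsum_coe] at this
  have hε : 0 < ν.real Set.univ := by
    rw [measureReal_def]
    exact ENNReal.toReal_pos (by simpa using hν0) (measure_ne_top _ _)
  set ε := ν.real Set.univ with hεdef
  obtain ⟨s, hs⟩ : ∃ s : Finset ℕ+, 1 - ∑ k ∈ s, (ρ k).toReal < ε / 4 := by
    have h1 : ∀ᶠ s : Finset ℕ+ in atTop, 1 - ε / 4 < ∑ k ∈ s, (ρ k).toReal :=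
      hsum.eventually (lt_mem_nhds (by linarith))
    obtain ⟨s, hs⟩ := h1.exists
    exact ⟨s, by linarith⟩
  set t := 1 - ∑ k ∈ s, (ρ k).toReal with ht
  have hprob : ∀ x, IsProbabilityMeasure (Measure.sum fun k : ℕ+ => ρ k • (Ψ ^ (k : ℕ)) x) := by
    intro x
    refine ⟨?_⟩
    rw [Measure.sum_apply _ MeasurableSet.univ]
    simp [ρ.tsum_coe]
  have ht0 : 0 ≤ t := by
    have := sum_le_hasSum s (fun k _ => ENNReal.toReal_nonneg) hsum
    linarith
  have hε1 : ε ≤ 1 := by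
    obtain ⟨x⟩ := ‹Nonempty D›
    have h1 := hprob x
    have := (measureReal_mono (μ := ν) (Set.subset_univ Set.univ)).trans
      (ENNReal.toReal_mono (measure_ne_top _ _) (hν x Set.univ))
    simpa using this
  -- `1 - ε` is the mass of the remainder `∑ k, ρ k Ψ ^ k - ν`; each `t` is a truncation error
  have hc0 : 0 ≤ 1 - ε + 2 * t := by linarith
  refine ⟨s, lt_of_le_of_lt (ContinuousLinearMap.opNorm_le_bound _ hc0 fun f => ?_)
    (show 1 - ε + 2 * t < 1 by linarith)⟩
  refine norm_le _ (by positivity) fun x => ?_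
  have hK := hprob x
  have e1 : (∑ k ∈ s, (ρ k).toReal • kernelOp Ψ ^ (k : ℕ)
      + t • (1 : BoundedMeasurable D →L[ℝ] BoundedMeasurable D) - meanOp ν) f x
      = ∑ k ∈ s, (ρ k).toReal * ∫ y, f y ∂((Ψ ^ (k : ℕ)) x) + t * f x - ∫ y, f y ∂ν := by
    rw [sub_apply, add_apply, sum_apply, coe_sub, coe_add, coe_sum, meanOp_apply]
    congr 2
    refine Finset.sum_congr rfl fun k _ => ?_
    rw [← kernelOp_pow_apply]
    rfl
  rw [e1]
  have hhs : HasSum (fun k : ℕ+ => (ρ k).toReal * ∫ y, f y ∂((Ψ ^ (k : ℕ)) x))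
      (∫ y, f y ∂(Measure.sum fun k : ℕ+ => ρ k • (Ψ ^ (k : ℕ)) x)) := by
    have := hasSum_integral_measure (f.integrable
      (Measure.sum fun k : ℕ+ => ρ k • (Ψ ^ (k : ℕ)) x))
    simpa only [integral_smul_measure, smul_eq_mul] using this
  have htail : |∑ k ∈ s, (ρ k).toReal * ∫ y, f y ∂((Ψ ^ (k : ℕ)) x)
      - ∫ y, f y ∂(Measure.sum fun k : ℕ+ => ρ k • (Ψ ^ (k : ℕ)) x)| ≤ t * ‖f‖ := by
    have h1 := (s.hasSum_compl_iff (f := fun k : ℕ+ =>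
      (ρ k).toReal * ∫ y, f y ∂((Ψ ^ (k : ℕ)) x))
      (a := (∫ y, f y ∂(Measure.sum fun k : ℕ+ => ρ k • (Ψ ^ (k : ℕ)) x))
        - ∑ k ∈ s, (ρ k).toReal * ∫ y, f y ∂((Ψ ^ (k : ℕ)) x))).2 (by simpa using hhs)
    have h2 := (s.hasSum_compl_iff (f := fun k : ℕ+ => (ρ k).toReal) (a := t)).2
      (by simpa [ht] using hsum)
    rw [abs_sub_comm, ← Real.norm_eq_abs, ← h1.tsum_eq]
    refine tsum_of_norm_bounded (h2.mul_right ‖f‖) fun k => ?_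
    rw [norm_mul, Real.norm_of_nonneg ENNReal.toReal_nonneg]
    gcongr
    refine (f.abs_integral_le _).trans_eq ?_
    rw [probReal_univ, mul_one]
  have hmin := abs_integral_sub_integral_le_of_le (hν x) f
  rw [probReal_univ, ← hεdef] at hmin
  have hself : |t * f x| ≤ t * ‖f‖ := by
    rw [abs_mul, abs_of_nonneg ht0]
    exact mul_le_mul_of_nonneg_left (f.abs_apply_le x) ht0
  rw [abs_le] at *
  constructor <;> nlinarith [hmin.1, hmin.2, hself.1, hself.2, htail.1, htail.2]

theorem integral_bind_kernel {α β : Type*} [MeasurableSpace α] [MeasurableSpace β]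
    {μ : Measure α} [IsFiniteMeasure μ] {κ : Kernel α β} [IsMarkovKernel κ] {f : β → ℝ}
    (hf : Integrable f (μ.bind κ)) : ∫ y, f y ∂(μ.bind κ) = ∫ x, ∫ y, f y ∂(κ x) ∂μ := by
  have h1 : Integrable (fun p : α × β => f p.2) (μ ⊗ₘ κ) := by
    rw [← Measure.snd_compProd] at hf
    exact (integrable_map_measure hf.1 measurable_snd.aemeasurable).1 hf
  rw [← Measure.integral_compProd h1, ← Measure.snd_compProd]
  rw [← Measure.snd_compProd] at hf
  exact integral_map measurable_snd.aemeasurable hf.1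

theorem integrable_integral_of_integrable_bind {α β : Type*} [MeasurableSpace α]
    [MeasurableSpace β] {μ : Measure α} [IsFiniteMeasure μ] {κ : Kernel α β} [IsMarkovKernel κ]
    {f : β → ℝ} (hf : Integrable f (μ.bind κ)) : Integrable (fun x => ∫ y, f y ∂(κ x)) μ := by
  rw [← Measure.snd_compProd] at hf
  exact ((integrable_map_measure hf.1 measurable_snd.aemeasurable).1 hf).integral_compProd

theorem ProbabilityTheory.Kernel.Invariant.integral_integral {D : Type*} [MeasurableSpace D]
    {Ψ : Kernel D D} [IsMarkovKernel Ψ] {ψ : Measure D} [IsFiniteMeasure ψ]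
    (hψ : Kernel.Invariant Ψ ψ) {f : D → ℝ} (hf : Integrable f ψ) :
    ∫ x, ∫ y, f y ∂(Ψ x) ∂ψ = ∫ x, f x ∂ψ := by
  rw [← integral_bind_kernel (by rwa [hψ.def]), hψ.def]

/-- Every measurable `g` with `|g| ≤ b` and mean zero under `ψ` is of the form `F - Ψ F`, with `F`
measurable and bounded by `A * b`. -/
def HasPoissonBound {D : Type*} [MeasurableSpace D] (Ψ : Kernel D D) (ψ : Measure D) (A : ℝ) :
    Prop :=
  ∀ (g : D → ℝ) (b : ℝ), Measurable g → (∀ x, |g x| ≤ b) → ∫ x, g x ∂ψ = 0 →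
    ∃ F : D → ℝ, Measurable F ∧ (∀ x, |F x| ≤ A * b) ∧ ∀ x, F x - ∫ y, F y ∂(Ψ x) = g x

open BoundedMeasurable in
/-- The Poisson equation `F - Ψ F = g` has a bounded solution for every bounded `g` of mean zero,
with a bound on `F` that is linear in that of `g`. With `V` the contraction of
`exists_norm_truncated_lt_one`, `1 - V` is invertible and factors as `(1 - Ψ) S + ν(·) 1`; if
`(1 - V) f = g`, then integration against `ψ` gives `ν(f) = 0`, so that `F = S f` is a solution. -/
theorem IsPetiteSpace.exists_hasPoissonBound {D : Type*} [MeasurableSpace D] {Ψ : Kernel D D}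
    [IsMarkovKernel Ψ] (hpetite : IsPetiteSpace Ψ) {ψ : Measure D} [IsProbabilityMeasure ψ]
    (hψ : Kernel.Invariant Ψ ψ) :
    ∃ A : ℝ, HasPoissonBound Ψ ψ A := by
  obtain ⟨ρ, ν, hν0, hν⟩ := hpetite
  have hne : Nonempty D := nonempty_of_isProbabilityMeasure ψ
  have hmk := isMarkovKernel_pow Ψ
  have hle : ∀ x, ν ≤ Measure.sum fun k : ℕ+ => ρ k • (Ψ ^ (k : ℕ)) x := by
    refine fun x => Measure.le_iff.2 fun A hA => ?_
    rw [Measure.sum_apply _ hA]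
    simpa using (hν A hA).trans (iInf_le _ x)
  have hfin : IsFiniteMeasure ν := by
    obtain ⟨x⟩ := hne
    refine ⟨lt_of_le_of_lt (hle x Set.univ) ?_⟩
    rw [Measure.sum_apply _ MeasurableSet.univ]
    simp [ρ.tsum_coe]
  obtain ⟨s, hs⟩ := exists_norm_truncated_lt_one Ψ ρ ν hν0 hle
  set T := kernelOp Ψ with hT
  set V := ∑ k ∈ s, (ρ k).toReal • T ^ (k : ℕ)
      + (1 - ∑ k ∈ s, (ρ k).toReal) • (1 : BoundedMeasurable D →L[ℝ] BoundedMeasurable D)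
      - meanOp ν with hV
  set S := ∑ k ∈ s, (ρ k).toReal • ∑ j ∈ Finset.range (k : ℕ), T ^ j with hS
  -- geometric sums: `1 - T ^ k = (1 - T) (1 + T + ⋯ + T ^ (k - 1))`
  have hfac : 1 - V = (1 - T) * S + meanOp ν := by
    rw [hS, Finset.mul_sum]
    simp_rw [mul_smul_comm, mul_neg_geom_sum, smul_sub]
    rw [hV, Finset.sum_sub_distrib, ← Finset.sum_smul, sub_smul, one_smul]
    abel
  set U := Units.oneSub V hs with hU
  have hUval : (U : BoundedMeasurable D →L[ℝ] BoundedMeasurable D) = 1 - V := rfl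
  refine ⟨‖S‖ * ‖((U⁻¹ : _ˣ) : BoundedMeasurable D →L[ℝ] BoundedMeasurable D)‖,
    fun g b hg hb hmean => ?_⟩
  have hb0 : 0 ≤ b := by
    obtain ⟨x⟩ := hne
    exact (abs_nonneg _).trans (hb x)
  set g' := BoundedMeasurable.mk g hg b hb with hg'
  set f := ((U⁻¹ : _ˣ) : BoundedMeasurable D →L[ℝ] BoundedMeasurable D) g' with hf
  have hUf : (1 - V) f = g' := by
    rw [hf, ← hUval]
    change (((U : BoundedMeasurable D →L[ℝ] BoundedMeasurable D)
      * ((U⁻¹ : _ˣ) : BoundedMeasurable D →L[ℝ] BoundedMeasurable D)) g') = g'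
    rw [Units.mul_inv]
    rfl
  set F := S f with hF
  have hpt : ∀ x, F x - ∫ y, F y ∂(Ψ x) + ∫ y, f y ∂ν = g x := by
    intro x
    have : ((1 - V) f) x = g x := by rw [hUf]; rfl
    rw [hfac] at this
    exact this
  have hinv : ∫ x, ∫ y, F y ∂(Ψ x) ∂ψ = ∫ x, F x ∂ψ :=
    hψ.integral_integral (F.integrable ψ)
  have hint : Integrable (fun x => ∫ y, F y ∂(Ψ x)) ψ := (T F).integrable ψ
  -- `ψ` annihilates `F - Ψ F` and `g`
  have hνf : ∫ y, f y ∂ν = 0 := by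
    have h1 : ∫ x, (F x - ∫ y, F y ∂(Ψ x) + ∫ y, f y ∂ν) ∂ψ = 0 := by
      simp_rw [hpt]
      exact hmean
    have h2 : ∫ x, (F x - ∫ y, F y ∂(Ψ x)) ∂ψ = 0 := by
      rw [integral_sub (F.integrable ψ) hint, hinv, sub_self]
    have h3 := integral_add (μ := ψ) (f := fun x => F x - ∫ y, F y ∂(Ψ x))
      (g := fun _ => ∫ y, f y ∂ν) ((F.integrable ψ).sub hint) (integrable_const _)
    rw [h1, h2] at h3
    simpa using h3.symm
  refine ⟨F, F.measurable, fun x => ?_, fun x => ?_⟩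
  · refine (F.abs_apply_le x).trans ?_
    have hgb : ‖g'‖ ≤ b := norm_le _ hb0 hb
    rw [mul_assoc]
    refine (S.le_opNorm f).trans ?_
    gcongr
    exact (ContinuousLinearMap.le_opNorm _ g').trans (by gcongr)
  · have := hpt x
    rwa [hνf, add_zero] at this

/-! ### Maximal inequality for additive functionals of a Markov chain -/

/-- Kolmogorov's maximal inequality for the partial sums of square integrable martingale
differences `d i`, where `d i` is measurable with respect to `ℱ (i + 1)`. -/
theorem measure_exists_le_abs_sum_le {Ω : Type*} {m0 : MeasurableSpace Ω} {Q : Measure Ω}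
    [IsFiniteMeasure Q] (ℱ : Filtration ℕ m0) (d : ℕ → Ω → ℝ)
    (hd : ∀ i, StronglyMeasurable[ℱ (i + 1)] (d i)) (hL2 : ∀ i, MemLp (d i) 2 Q)
    (hcond : ∀ i s, MeasurableSet[ℱ i] s → ∫ ω in s, d i ω ∂Q = 0)
    {v : ℝ} (hv : ∀ i, ∫ ω, d i ω ^ 2 ∂Q ≤ v) {a : ℝ} (ha : 0 < a) (m : ℕ) :
    Q {ω | ∃ j ≤ m, a ≤ |∑ i ∈ Finset.range j, d i ω|} ≤ ENNReal.ofReal (m * v / a ^ 2) := by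
  set M : ℕ → Ω → ℝ := fun j ω => ∑ i ∈ Finset.range j, d i ω with hM
  have hMm : ∀ j, StronglyMeasurable[ℱ j] (M j) := fun j =>
    Finset.stronglyMeasurable_fun_sum _ fun i hi =>
      (hd i).mono (ℱ.mono (Nat.succ_le_of_lt (Finset.mem_range.1 hi)))
  have hML2 : ∀ j, MemLp (M j) 2 Q := fun j => memLp_finsetSum _ fun i _ => hL2 i
  have hcondExp : ∀ i, Q[d i | ℱ i] =ᵐ[Q] 0 := fun i => by
    refine (ae_eq_condExp_of_forall_setIntegral_eq (ℱ.le i)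
      ((hL2 i).integrable one_le_two) (fun s _ _ => integrableOn_zero) (fun s hs _ => ?_)
      aestronglyMeasurable_zero).symm
    rw [hcond i s hs]
    simp
  have hMd : ∀ i, Integrable (M i * d i) Q := fun i => (hML2 i).integrable_mul (hL2 i)
  -- increments are orthogonal to the past, also on events of the past
  have hcross : ∀ i s, MeasurableSet[ℱ i] s → ∫ ω in s, (M i * d i) ω ∂Q = 0 := by
    intro i s hs
    rw [← setIntegral_condExp (ℱ.le i) (hMd i) hs]
    have h1 := condExp_mul_of_stronglyMeasurable_left (hMm i) (hMd i)
      ((hL2 i).integrable one_le_two)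
    have h2 : Q[M i * d i | ℱ i] =ᵐ[Q] 0 := by
      filter_upwards [h1, hcondExp i] with ω hω1 hω2
      rw [hω1, Pi.mul_apply, hω2]
      simp
    rw [integral_congr_ae (ae_restrict_of_ae h2)]
    simp
  have hint2 : ∀ i, Integrable (fun ω => M i ω ^ 2) Q := fun i => (hML2 i).integrable_sq
  have hd2 : ∀ i, Integrable (fun ω => d i ω ^ 2) Q := fun i => (hL2 i).integrable_sq
  have hstep : ∀ i s, MeasurableSet[ℱ i] s → ∫ ω in s, M (i + 1) ω ^ 2 ∂Q
      = ∫ ω in s, M i ω ^ 2 ∂Q + ∫ ω in s, d i ω ^ 2 ∂Q := by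
    intro i s hs
    have e : ∀ ω, M (i + 1) ω ^ 2 = (M i ω ^ 2 + 2 * (M i * d i) ω) + d i ω ^ 2 := fun ω => by
      simp only [hM, Finset.sum_range_succ, Pi.mul_apply]
      ring
    simp_rw [e]
    have hI : Integrable (fun ω => M i ω ^ 2 + 2 * (M i * d i) ω) Q :=
      (hint2 i).add ((hMd i).const_mul 2)
    rw [integral_add hI.integrableOn (hd2 i).integrableOn,
      integral_add (hint2 i).integrableOn ((hMd i).const_mul 2).integrableOn,
      integral_const_mul, hcross i s hs]
    ring
  have hsub : Submartingale (fun i ω => M i ω ^ 2) ℱ Q := by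
    refine submartingale_of_setIntegral_le_succ (fun i => (hMm i).pow 2) hint2 fun i s hs => ?_
    rw [hstep i s hs]
    exact le_add_of_nonneg_right (integral_nonneg fun ω => sq_nonneg _)
  have hvar : ∀ j : ℕ, ∫ ω, M j ω ^ 2 ∂Q ≤ j * v := by
    intro j
    induction j with
    | zero => simp [hM]
    | succ j ih =>
      have := hstep j Set.univ MeasurableSet.univ
      simp only [setIntegral_univ] at this
      rw [this]
      push_cast
      linarith [hv j]
  obtain ⟨e, he⟩ : ∃ e : NNReal, (e : ℝ) = a ^ 2 := ⟨⟨a ^ 2, sq_nonneg a⟩, rfl⟩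
  have hmax := maximal_ineq hsub (fun i ω => sq_nonneg _) (ε := e) m
  have hset : {ω | ∃ j ≤ m, a ≤ |∑ i ∈ Finset.range j, d i ω|} ⊆
      {ω | (e : ℝ) ≤
        (Finset.range (m + 1)).sup' Finset.nonempty_range_add_one fun k => M k ω ^ 2} := by
    rintro ω ⟨j, hj, hω⟩
    refine le_trans ?_ (Finset.le_sup' (fun k => M k ω ^ 2)
      (Finset.mem_range.2 (Nat.lt_succ_of_le hj)))
    rw [he, ← sq_abs (M j ω)]
    exact pow_le_pow_left₀ ha.le hω 2
  rw [ENNReal.ofReal_div_of_pos (by positivity), ENNReal.le_div_iff_mul_le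
    (Or.inl (by simpa using ha.ne')) (Or.inl ENNReal.ofReal_ne_top), mul_comm, ← he,
    ENNReal.ofReal_coe_nnreal]
  refine (mul_le_mul_right (measure_mono hset) _).trans (hmax.trans ?_)
  refine ENNReal.ofReal_le_ofReal (le_trans ?_ (hvar m))
  exact setIntegral_le_integral (hint2 m) (ae_of_all _ fun ω => sq_nonneg _)

theorem measurable_pastSigma {Ω D : Type*} [MeasurableSpace D] {Z : ℕ → Ω → D} {j k : ℕ}
    (hjk : j ≤ k) : Measurable[pastSigma Z k] (Z j) :=
  Measurable.mono (comap_measurable (Z j))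
    (le_iSup₂_of_le (f := fun j _ => MeasurableSpace.comap (Z j) inferInstance) j
      (Finset.mem_range.2 (Nat.lt_succ_of_le hjk)) le_rfl) le_rfl

theorem pastSigma_mono {Ω D : Type*} [MeasurableSpace D] {Z : ℕ → Ω → D} {j k : ℕ}
    (hjk : j ≤ k) : pastSigma Z j ≤ pastSigma Z k :=
  iSup₂_le fun i hi => le_iSup₂_of_le
    (f := fun j _ => MeasurableSpace.comap (Z j) inferInstance) i
    (Finset.mem_range.2 ((Finset.mem_range.1 hi).trans_le (Nat.succ_le_succ hjk))) le_rfl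

theorem IsMarkovChain.pastSigma_le {Ω D : Type*} [MeasurableSpace Ω] [MeasurableSpace D]
    {Ψ : Kernel D D} {π : Measure D} {P : Measure Ω} {Z : ℕ → Ω → D}
    (hZ : IsMarkovChain Ψ π P Z) (k : ℕ) :
    pastSigma Z k ≤ (inferInstance : MeasurableSpace Ω) :=
  iSup₂_le fun j _ => (hZ.measurable j).comap_le

namespace IsMarkovChain

variable {Ω D : Type*} [MeasurableSpace Ω] [MeasurableSpace D] {Ψ : Kernel D D}
  [IsMarkovKernel Ψ] {π : Measure D} {P : Measure Ω} [IsProbabilityMeasure P] {Z : ℕ → Ω → D}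

/-- On an event of the past, the joint law of two consecutive states is the (defective) law of the
first, followed by a transition. -/
theorem map_prodMk_restrict (hZ : IsMarkovChain Ψ π P Z) {k : ℕ} {s : Set Ω}
    (hs : MeasurableSet[pastSigma Z k] s) :
    (P.restrict s).map (fun ω => (Z k ω, Z (k + 1) ω)) = ((P.restrict s).map (Z k)) ⊗ₘ Ψ := by
  have hm := hZ.measurable
  have hle := hZ.pastSigma_le k
  refine Measure.ext_prod fun {A B} hA hB => ?_
  have ht : MeasurableSet[pastSigma Z k] (Z k ⁻¹' A ∩ s) :=
    (measurable_pastSigma le_rfl hA).inter hs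
  rw [Measure.map_apply ((hm k).prodMk (hm (k + 1))) (hA.prod hB),
    Measure.compProd_apply_prod hA hB, setLIntegral_map hA (Ψ.measurable_coe hB) (hm k),
    Measure.restrict_restrict (hm k hA),
    Measure.restrict_apply (((hm k).prodMk (hm (k + 1))) (hA.prod hB))]
  have h1 := setIntegral_condExp (μ := P) hle
    (f := (Z (k + 1) ⁻¹' B).indicator fun _ => (1 : ℝ))
    ((integrable_const 1).indicator (hm (k + 1) hB)) ht
  rw [integral_congr_ae (ae_restrict_of_ae (hZ.markov k B hB)),
    integral_indicator_const _ (hm (k + 1) hB), smul_eq_mul, mul_one, measureReal_def,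
    Measure.restrict_apply (hm (k + 1) hB)] at h1
  have h2 : ∫⁻ ω in Z k ⁻¹' A ∩ s, Ψ (Z k ω) B ∂P
      = ENNReal.ofReal (∫ ω in Z k ⁻¹' A ∩ s, (Ψ (Z k ω)).real B ∂P) := by
    rw [ofReal_integral_eq_lintegral_ofReal]
    · exact lintegral_congr fun ω => by rw [ofReal_measureReal]
    · refine Integrable.of_bound (C := 1) ?_ (ae_of_all _ fun ω => ?_)
      · exact ((Ψ.measurable_coe hB).comp (hm k)).ennreal_toReal.aestronglyMeasurable
      · rw [Real.norm_of_nonneg measureReal_nonneg]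
        exact measureReal_le_one
    · exact ae_of_all _ fun ω => measureReal_nonneg
  rw [h2, h1, ENNReal.ofReal_toReal (measure_ne_top _ _)]
  congr 1
  ext ω
  simp only [Set.mem_inter_iff, Set.mem_preimage, Set.mem_prod]
  tauto

theorem map_succ_restrict (hZ : IsMarkovChain Ψ π P Z) {k : ℕ} {s : Set Ω}
    (hs : MeasurableSet[pastSigma Z k] s) :
    (P.restrict s).map (Z (k + 1)) = ((P.restrict s).map (Z k)).bind Ψ := by
  rw [← Measure.snd_compProd, ← hZ.map_prodMk_restrict hs, Measure.snd,
    Measure.map_map measurable_snd ((hZ.measurable k).prodMk (hZ.measurable (k + 1)))]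
  rfl

theorem map_succ (hZ : IsMarkovChain Ψ π P Z) (k : ℕ) :
    P.map (Z (k + 1)) = (P.map (Z k)).bind Ψ := by
  simpa using hZ.map_succ_restrict (k := k) MeasurableSet.univ

/-- Domination of the law of the state by a multiple of the invariant probability is preserved by
the transitions. -/
theorem map_restrict_le (hZ : IsMarkovChain Ψ π P Z) {ψ : Measure D} (hψ : Kernel.Invariant Ψ ψ)
    {k₀ : ℕ} {B : Set D} (hB : MeasurableSet B) {L : ℝ≥0∞}
    (hL : (P.restrict (Z k₀ ⁻¹' B)).map (Z k₀) ≤ L • ψ) {k : ℕ} (hk : k₀ ≤ k) :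
    (P.restrict (Z k₀ ⁻¹' B)).map (Z k) ≤ L • ψ := by
  induction k, hk using Nat.le_induction with
  | base => exact hL
  | succ k hk ih =>
    rw [hZ.map_succ_restrict (measurable_pastSigma hk hB)]
    refine Measure.le_iff.2 fun A hA => ?_
    rw [Measure.bind_apply hA Ψ.aemeasurable]
    refine (lintegral_mono' ih le_rfl).trans_eq ?_
    rw [lintegral_smul_measure, ← Measure.bind_apply hA Ψ.aemeasurable, hψ.def]
    rfl

/-- A maximal inequality for an additive functional with centred increments `u (Z k, Z (k + 1))`,
on an event that gives `Z k₀` a law dominated by a multiple of the invariant probability. -/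
theorem measure_exists_le_abs_sum_le (hZ : IsMarkovChain Ψ π P Z) {ψ : Measure D}
    [IsFiniteMeasure ψ] (hψ : Kernel.Invariant Ψ ψ) {k₀ : ℕ} {B : Set D} (hB : MeasurableSet B)
    {L : NNReal} (hL : (P.restrict (Z k₀ ⁻¹' B)).map (Z k₀) ≤ (L : ℝ≥0∞) • ψ) {u : D × D → ℝ}
    (hu : Measurable u) (hu2 : MemLp u 2 (ψ ⊗ₘ Ψ)) (hu0 : ∀ x, ∫ y, u (x, y) ∂(Ψ x) = 0)
    {a : ℝ} (ha : 0 < a) (m : ℕ) :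
    P.restrict (Z k₀ ⁻¹' B)
        {ω | ∃ j ≤ m, a ≤ |∑ i ∈ Finset.range j, u (Z (k₀ + i) ω, Z (k₀ + i + 1) ω)|}
      ≤ ENNReal.ofReal (m * (L * ∫ p, u p ^ 2 ∂(ψ ⊗ₘ Ψ)) / a ^ 2) := by
  set Q := P.restrict (Z k₀ ⁻¹' B) with hQ
  have hm := hZ.measurable
  let ℱ : Filtration ℕ (inferInstance : MeasurableSpace Ω) :=
    { seq := fun j => pastSigma Z (k₀ + j)
      mono' := fun i j hij => pastSigma_mono (by omega)
      le' := fun j => hZ.pastSigma_le _ }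
  have hpair : ∀ k, Measurable fun ω => (Z k ω, Z (k + 1) ω) := fun k => (hm k).prodMk (hm (k + 1))
  have hjoint : ∀ i, Q.map (fun ω => (Z (k₀ + i) ω, Z (k₀ + i + 1) ω)) ≤
      (L : ℝ≥0∞) • (ψ ⊗ₘ Ψ) := by
    intro i
    rw [hZ.map_prodMk_restrict (measurable_pastSigma (by omega) hB)]
    have h1 := hZ.map_restrict_le hψ hB hL (k := k₀ + i) (by omega)
    refine Measure.le_iff.2 fun A hA => ?_
    rw [Measure.compProd_apply hA]
    refine (lintegral_mono' h1 le_rfl).trans_eq ?_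
    rw [lintegral_smul_measure, Measure.smul_apply, Measure.compProd_apply hA]
  have hmem : ∀ i, MemLp u 2 (Q.map (fun ω => (Z (k₀ + i) ω, Z (k₀ + i + 1) ω))) := fun i =>
    (hu2.smul_measure ENNReal.coe_ne_top).mono_measure (hjoint i)
  refine _root_.measure_exists_le_abs_sum_le ℱ
    (fun i ω => u (Z (k₀ + i) ω, Z (k₀ + i + 1) ω)) (fun i => ?_) (fun i => ?_)
    (fun i s hs => ?_) (fun i => ?_) ha m
  · refine Measurable.stronglyMeasurable ?_
    exact hu.comp (Measurable.prodMk (measurable_pastSigma (by omega))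
      (measurable_pastSigma (by omega)))
  · exact (memLp_map_measure_iff hu.aestronglyMeasurable (hpair _).aemeasurable).1 (hmem i)
  · have hs' : MeasurableSet[pastSigma Z (k₀ + i)] (s ∩ Z k₀ ⁻¹' B) :=
      MeasurableSet.inter hs (measurable_pastSigma (by omega) hB)
    have hsm : MeasurableSet s := hZ.pastSigma_le _ s hs
    have hI : Integrable u ((P.restrict (s ∩ Z k₀ ⁻¹' B)).map
        (fun ω => (Z (k₀ + i) ω, Z (k₀ + i + 1) ω))) := by
      refine ((hmem i).integrable one_le_two).mono_measure ?_
      exact Measure.map_mono (Measure.restrict_mono_set _ Set.inter_subset_right) (hpair _)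
    rw [hQ, Measure.restrict_restrict hsm,
      ← integral_map (hpair _).aemeasurable hu.aestronglyMeasurable]
    rw [hZ.map_prodMk_restrict hs'] at hI ⊢
    rw [Measure.integral_compProd hI]
    simp [hu0]
  · have h1 := integral_map (μ := Q) (hpair (k₀ + i)).aemeasurable (f := fun p => u p ^ 2)
      (hu.pow_const 2).aestronglyMeasurable
    rw [← h1]
    refine (integral_mono_measure (hjoint i) (ae_of_all _ fun p => sq_nonneg (u p))
      ((hu2.integrable_sq).smul_measure ENNReal.coe_ne_top)).trans_eq ?_
    rw [integral_smul_measure]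
    rfl

end IsMarkovChain

/-! ### Variance of the martingale increments -/

theorem measurable_integral_kernel {α β : Type*} [MeasurableSpace α] [MeasurableSpace β]
    {κ : Kernel α β} {f : β → ℝ} (hf : Measurable f) : Measurable fun x => ∫ y, f y ∂(κ x) :=
  hf.stronglyMeasurable.integral_kernel.measurable

section Variance

variable {D : Type*} [MeasurableSpace D] {Ψ : Kernel D D} [IsMarkovKernel Ψ] {ψ : Measure D}
  [IsProbabilityMeasure ψ]

theorem ProbabilityTheory.Kernel.Invariant.measurePreserving_snd (hψ : Kernel.Invariant Ψ ψ) :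
    MeasurePreserving Prod.snd (ψ ⊗ₘ Ψ) ψ :=
  ⟨measurable_snd, (Measure.snd_compProd ψ Ψ).trans hψ.def⟩

theorem measurePreserving_fst_compProd : MeasurePreserving Prod.fst (ψ ⊗ₘ Ψ) ψ :=
  ⟨measurable_fst, Measure.fst_compProd ψ Ψ⟩

theorem MeasureTheory.MeasurePreserving.integral_comp_measurable {α β : Type*} [MeasurableSpace α]
    [MeasurableSpace β] {μ : Measure α} {ν : Measure β} {φ : α → β} (hφ : MeasurePreserving φ μ ν)
    {f : β → ℝ} (hf : Measurable f) : ∫ x, f (φ x) ∂μ = ∫ y, f y ∂ν := by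
  rw [← hφ.map_eq]
  exact (integral_map hφ.aemeasurable hf.aestronglyMeasurable).symm

theorem abs_integral_kernel_le {F : D → ℝ} {K : ℝ} (hK : ∀ x, |F x| ≤ K) (x : D) :
    |∫ y, F y ∂(Ψ x)| ≤ K := by
  have := norm_integral_le_of_norm_le_const (μ := Ψ x) (f := F) (C := K) (ae_of_all _ hK)
  simpa using this

theorem integral_abs_integral_kernel_le (hψ : Kernel.Invariant Ψ ψ) {h : D → ℝ}
    (hh : Integrable h ψ) : ∫ x, |∫ y, h y ∂(Ψ x)| ∂ψ ≤ ∫ x, |h x| ∂ψ := by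
  rw [← hψ.integral_integral hh.abs]
  refine integral_mono (integrable_integral_of_integrable_bind (by rwa [hψ.def])).abs
    (integrable_integral_of_integrable_bind (by rw [hψ.def]; exact hh.abs)) fun x => ?_
  exact abs_integral_le_integral_abs

/-- The variance of the increments `F y - Ψ F x` of a bounded function is of first order in
`F - Ψ F`: it equals `ψ(F²) - ψ((Ψ F)²) = ψ((F - Ψ F) (F + Ψ F))`. -/
theorem integral_sq_sub_integral_kernel_le (hψ : Kernel.Invariant Ψ ψ) {F : D → ℝ}
    (hF : Measurable F) {K : ℝ} (hK : ∀ x, |F x| ≤ K) :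
    ∫ p, (F p.2 - ∫ y, F y ∂(Ψ p.1)) ^ 2 ∂(ψ ⊗ₘ Ψ)
      ≤ 2 * K * ∫ x, |F x - ∫ y, F y ∂(Ψ x)| ∂ψ := by
  have hT : Measurable fun x => ∫ y, F y ∂(Ψ x) := measurable_integral_kernel hF
  have hTK : ∀ x, |∫ y, F y ∂(Ψ x)| ≤ K := abs_integral_kernel_le hK
  have hI : ∀ x, Integrable F (Ψ x) := fun x =>
    Integrable.of_bound hF.aestronglyMeasurable K (ae_of_all _ hK)
  have hIψ : Integrable F ψ := Integrable.of_bound hF.aestronglyMeasurable K (ae_of_all _ hK)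
  have hTψ : Integrable (fun x => ∫ y, F y ∂(Ψ x)) ψ :=
    Integrable.of_bound hT.aestronglyMeasurable K (ae_of_all _ hTK)
  have hsq : ∀ {a : ℝ}, |a| ≤ K → ‖a ^ 2‖ ≤ K ^ 2 := fun {a} ha => by
    rw [norm_pow]
    exact pow_le_pow_left₀ (norm_nonneg _) ha 2
  have hI2 : ∀ x, Integrable (fun y => F y ^ 2) (Ψ x) := fun x =>
    Integrable.of_bound (hF.pow_const 2).aestronglyMeasurable (K ^ 2)
      (ae_of_all _ fun y => hsq (hK y))
  have hI2ψ : Integrable (fun y => F y ^ 2) ψ :=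
    Integrable.of_bound (hF.pow_const 2).aestronglyMeasurable (K ^ 2)
      (ae_of_all _ fun y => hsq (hK y))
  have hT2ψ : Integrable (fun x => (∫ y, F y ∂(Ψ x)) ^ 2) ψ :=
    Integrable.of_bound (hT.pow_const 2).aestronglyMeasurable (K ^ 2)
      (ae_of_all _ fun y => hsq (hTK y))
  have hpI : Integrable (fun p : D × D => (F p.2 - ∫ y, F y ∂(Ψ p.1)) ^ 2) (ψ ⊗ₘ Ψ) := by
    refine Integrable.of_bound (C := (K + K) ^ 2) ?_ (ae_of_all _ fun p => ?_)
    · exact (((hF.comp measurable_snd).sub (hT.comp measurable_fst)).pow_const 2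
        ).aestronglyMeasurable
    · rw [norm_pow]
      exact pow_le_pow_left₀ (norm_nonneg _)
        ((norm_sub_le _ _).trans (add_le_add (hK _) (hTK _))) 2
  have hin : ∀ x, ∫ y, (F y - ∫ z, F z ∂(Ψ x)) ^ 2 ∂(Ψ x)
      = ∫ y, F y ^ 2 ∂(Ψ x) - (∫ y, F y ∂(Ψ x)) ^ 2 := by
    intro x
    set t := ∫ z, F z ∂(Ψ x) with ht
    have e : ∀ y, (F y - t) ^ 2 = (F y ^ 2 - 2 * t * F y) + t ^ 2 := fun y => by ring
    simp_rw [e]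
    have h1 : Integrable (fun y => F y ^ 2 - 2 * t * F y) (Ψ x) := (hI2 x).sub ((hI x).const_mul _)
    rw [integral_add h1 (integrable_const _), integral_sub (hI2 x) ((hI x).const_mul _),
      integral_const_mul, ← ht]
    simp
    ring
  rw [Measure.integral_compProd hpI]
  simp_rw [hin]
  rw [integral_sub (integrable_integral_of_integrable_bind (by rwa [hψ.def])) hT2ψ,
    hψ.integral_integral hI2ψ, ← integral_sub hI2ψ hT2ψ, ← integral_const_mul]
  refine integral_mono (hI2ψ.sub hT2ψ) ((hIψ.sub hTψ).abs.const_mul _) fun x => ?_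
  set t := ∫ y, F y ∂(Ψ x) with ht
  calc F x ^ 2 - t ^ 2 = (F x - t) * (F x + t) := by ring
    _ ≤ |F x - t| * |F x + t| := by rw [← abs_mul]; exact le_abs_self _
    _ ≤ |F x - t| * (K + K) := by
        gcongr
        exact (abs_add_le _ _).trans (add_le_add (hK x) (hTK x))
    _ = 2 * K * |F x - t| := by ring

/-- Square integrability and variance of the martingale increment that the solution `F` of the
Poisson equation for `Ψ h` attaches to `h`. Beyond `ψ(h²)` the bound involves only `ψ(|h|)`,
not its square root or a constant. -/
theorem memLp_poisson_increment (hψ : Kernel.Invariant Ψ ψ) {h : D → ℝ} (hh : Measurable h)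
    {C : ℝ} (hC : ∀ x, |∫ y, h y ∂(Ψ x)| ≤ C) (hh2 : MemLp h 2 ψ) {F : D → ℝ} (hF : Measurable F)
    {K : ℝ} (hK : ∀ x, |F x| ≤ K)
    (hP : ∀ x, F x - ∫ y, F y ∂(Ψ x) = ∫ y, h y ∂(Ψ x) - ∫ y, h y ∂ψ) :
    MemLp (fun p : D × D => h p.2 + F p.2 - F p.1 - ∫ y, h y ∂ψ) 2 (ψ ⊗ₘ Ψ) ∧
    ∫ p, (h p.2 + F p.2 - F p.1 - ∫ y, h y ∂ψ) ^ 2 ∂(ψ ⊗ₘ Ψ)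
      ≤ 4 * ∫ x, h x ^ 2 ∂ψ + (4 * C + 8 * K) * ∫ x, |h x| ∂ψ := by
  have hT : Measurable fun x => ∫ y, h y ∂(Ψ x) := measurable_integral_kernel hh
  have hTF : Measurable fun x => ∫ y, F y ∂(Ψ x) := measurable_integral_kernel hF
  have hfst := measurePreserving_fst_compProd (Ψ := Ψ) (ψ := ψ)
  have hsnd := hψ.measurePreserving_snd
  have hh1 : Integrable h ψ := hh2.integrable one_le_two
  have hK0 : 0 ≤ K := by
    obtain ⟨x⟩ := nonempty_of_isProbabilityMeasure ψ
    exact (abs_nonneg _).trans (hK x)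
  have hTmem : MemLp (fun x => ∫ y, h y ∂(Ψ x)) 2 ψ :=
    MemLp.of_bound hT.aestronglyMeasurable C (ae_of_all _ hC)
  have hFmem : MemLp F 2 ψ := MemLp.of_bound hF.aestronglyMeasurable K (ae_of_all _ hK)
  have hTFmem : MemLp (fun x => ∫ y, F y ∂(Ψ x)) 2 ψ :=
    MemLp.of_bound hTF.aestronglyMeasurable K (ae_of_all _ (abs_integral_kernel_le hK))
  have m1 : MemLp (fun p : D × D => h p.2) 2 (ψ ⊗ₘ Ψ) := hh2.comp_measurePreserving hsnd
  have m2 : MemLp (fun p : D × D => F p.2) 2 (ψ ⊗ₘ Ψ) := hFmem.comp_measurePreserving hsnd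
  have m3 : MemLp (fun p : D × D => F p.1) 2 (ψ ⊗ₘ Ψ) := hFmem.comp_measurePreserving hfst
  have m4 : MemLp (fun p : D × D => ∫ y, h y ∂(Ψ p.1)) 2 (ψ ⊗ₘ Ψ) :=
    hTmem.comp_measurePreserving hfst
  have m5 : MemLp (fun p : D × D => ∫ y, F y ∂(Ψ p.1)) 2 (ψ ⊗ₘ Ψ) :=
    hTFmem.comp_measurePreserving hfst
  have hmem : MemLp (fun p : D × D => h p.2 + F p.2 - F p.1 - ∫ y, h y ∂ψ) 2 (ψ ⊗ₘ Ψ) :=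
    ((m1.add m2).sub m3).sub (memLp_const _)
  refine ⟨hmem, ?_⟩
  have i1 := m1.integrable_sq
  have i4 := m4.integrable_sq
  have i25 : Integrable (fun p : D × D => (F p.2 - ∫ y, F y ∂(Ψ p.1)) ^ 2) (ψ ⊗ₘ Ψ) :=
    (m2.sub m5).integrable_sq
  have hle : ∀ p : D × D, (h p.2 + F p.2 - F p.1 - ∫ y, h y ∂ψ) ^ 2 ≤
      (4 * h p.2 ^ 2 + 4 * (∫ y, h y ∂(Ψ p.1)) ^ 2) + 2 * (F p.2 - ∫ y, F y ∂(Ψ p.1)) ^ 2 := by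
    intro p
    have e : h p.2 + F p.2 - F p.1 - ∫ y, h y ∂ψ
        = (h p.2 - ∫ y, h y ∂(Ψ p.1)) + (F p.2 - ∫ y, F y ∂(Ψ p.1)) := by
      linarith [hP p.1]
    rw [e]
    nlinarith [sq_nonneg ((h p.2 - ∫ y, h y ∂(Ψ p.1)) - (F p.2 - ∫ y, F y ∂(Ψ p.1))),
      sq_nonneg (h p.2 + ∫ y, h y ∂(Ψ p.1))]
  have i14 : Integrable (fun p : D × D => 4 * h p.2 ^ 2 + 4 * (∫ y, h y ∂(Ψ p.1)) ^ 2)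
      (ψ ⊗ₘ Ψ) := (i1.const_mul 4).add (i4.const_mul 4)
  refine (integral_mono hmem.integrable_sq (i14.add (i25.const_mul 2)) hle).trans ?_
  have hsplit := integral_add i14 (i25.const_mul 2)
  rw [integral_add (i1.const_mul 4) (i4.const_mul 4), integral_const_mul, integral_const_mul,
    integral_const_mul, hsnd.integral_comp_measurable (hh.pow_const 2),
    hfst.integral_comp_measurable (hT.pow_const 2)] at hsplit
  refine hsplit.le.trans ?_
  have b1 : ∫ x, (∫ y, h y ∂(Ψ x)) ^ 2 ∂ψ ≤ C * ∫ x, |h x| ∂ψ := by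
    have hC0 : 0 ≤ C := by
      obtain ⟨x⟩ := nonempty_of_isProbabilityMeasure ψ
      exact (abs_nonneg _).trans (hC x)
    have hTi := hTmem.integrable one_le_two
    calc ∫ x, (∫ y, h y ∂(Ψ x)) ^ 2 ∂ψ ≤ ∫ x, C * |∫ y, h y ∂(Ψ x)| ∂ψ := by
          refine integral_mono hTmem.integrable_sq (hTi.abs.const_mul C) fun x => ?_
          change (∫ y, h y ∂(Ψ x)) ^ 2 ≤ C * |∫ y, h y ∂(Ψ x)|
          rw [← sq_abs, sq]
          exact mul_le_mul_of_nonneg_right (hC x) (abs_nonneg _)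
      _ = C * ∫ x, |∫ y, h y ∂(Ψ x)| ∂ψ := integral_const_mul _ _
      _ ≤ _ := mul_le_mul_of_nonneg_left (integral_abs_integral_kernel_le hψ hh1) hC0
  have b2 := integral_sq_sub_integral_kernel_le hψ hF hK
  have b3 : ∫ x, |F x - ∫ y, F y ∂(Ψ x)| ∂ψ ≤ 2 * ∫ x, |h x| ∂ψ := by
    have hTi := hTmem.integrable one_le_two
    simp_rw [hP]
    calc ∫ x, |∫ y, h y ∂(Ψ x) - ∫ y, h y ∂ψ| ∂ψ
        ≤ ∫ x, (|∫ y, h y ∂(Ψ x)| + |∫ y, h y ∂ψ|) ∂ψ :=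
          integral_mono (hTi.sub (integrable_const _)).abs (hTi.abs.add (integrable_const _))
            fun x => abs_sub _ _
      _ = ∫ x, |∫ y, h y ∂(Ψ x)| ∂ψ + |∫ y, h y ∂ψ| := by
          rw [integral_add hTi.abs (integrable_const _)]
          simp
      _ ≤ 2 * ∫ x, |h x| ∂ψ := by
          have h1 := integral_abs_integral_kernel_le hψ hh1
          have h2 : |∫ y, h y ∂ψ| ≤ ∫ x, |h x| ∂ψ := abs_integral_le_integral_abs
          linarith
  nlinarith [mul_le_mul_of_nonneg_left b3 hK0]

end Variance

/-! ### Estimates on an event of dominated law -/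

/-- Telescoping along a trajectory: up to boundary terms, the centred additive functional is the
sum of the increments `h y + F y - F x - μ`. -/
theorem abs_sum_sub_le_of_forall_abs_sum_lt {D : Type*} {h F : D → ℝ} {K : ℝ}
    (hK : ∀ x, |F x| ≤ K) (μ : ℝ) (z : ℕ → D) {k₀ N : ℕ} {a b : ℝ} (hb0 : 0 ≤ b)
    (hb : ∀ k ∈ Finset.Icc 1 k₀, |h (z k)| ≤ b)
    (ha : ∀ j ≤ N, |∑ i ∈ Finset.range j,
      (h (z (k₀ + i + 1)) + F (z (k₀ + i + 1)) - F (z (k₀ + i)) - μ)| < a)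
    {J : ℕ} (hJ : J ≤ N) :
    |∑ k ∈ Finset.Icc 1 J, h (z k) - J * μ| ≤ k₀ * b + a + (k₀ * |μ| + 2 * K) := by
  have ha0 : 0 < a := by simpa using ha 0 (Nat.zero_le _)
  have hK0 : 0 ≤ K := (abs_nonneg _).trans (hK (z 0))
  have hinit : ∀ J ≤ k₀, |∑ k ∈ Finset.Icc 1 J, h (z k) - J * μ| ≤ k₀ * b + k₀ * |μ| := by
    intro J hJ
    have h1 : |∑ k ∈ Finset.Icc 1 J, h (z k)| ≤ J * b := by
      refine (Finset.abs_sum_le_sum_abs _ _).trans ?_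
      refine (Finset.sum_le_card_nsmul _ _ b fun k hk => hb k ?_).trans_eq ?_
      · rw [Finset.mem_Icc] at hk ⊢
        omega
      · simp
    have h2 : (J : ℝ) ≤ k₀ := by exact_mod_cast hJ
    calc |∑ k ∈ Finset.Icc 1 J, h (z k) - J * μ|
        ≤ |∑ k ∈ Finset.Icc 1 J, h (z k)| + |J * μ| := abs_sub _ _
      _ ≤ J * b + J * |μ| := by rw [abs_mul, Nat.abs_cast]; gcongr
      _ ≤ k₀ * b + k₀ * |μ| := by gcongr
  rcases le_total J k₀ with hJk | hJk
  · linarith [hinit J hJk]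
  obtain ⟨j, rfl⟩ := Nat.exists_eq_add_of_le hJk
  have e1 : ∀ j : ℕ, ∑ k ∈ Finset.Icc 1 (k₀ + j), h (z k)
      = ∑ k ∈ Finset.Icc 1 k₀, h (z k) + ∑ i ∈ Finset.range j, h (z (k₀ + i + 1)) := by
    intro j
    induction j with
    | zero => simp
    | succ j ih =>
      rw [← add_assoc, Finset.sum_Icc_succ_top (by omega), ih, Finset.sum_range_succ, add_assoc]
  have e2 : ∑ i ∈ Finset.range j, (h (z (k₀ + i + 1)) + F (z (k₀ + i + 1)) - F (z (k₀ + i)) - μ)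
      = ∑ i ∈ Finset.range j, h (z (k₀ + i + 1)) + (F (z (k₀ + j)) - F (z k₀)) - j * μ := by
    have := Finset.sum_range_sub (fun i => F (z (k₀ + i))) j
    simp only [← add_assoc, add_zero] at this
    rw [← this, ← Finset.sum_add_distrib, ← nsmul_eq_mul, ← Finset.card_range j,
      ← Finset.sum_const, Finset.card_range, ← Finset.sum_sub_distrib]
    exact Finset.sum_congr rfl fun i _ => by ring
  have h1 := ha j (by omega)
  rw [e2] at h1
  have h2 := hinit k₀ le_rfl
  have h3 := hK (z (k₀ + j))
  have h4 := hK (z k₀)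
  rw [e1 j]
  push_cast
  rw [abs_le] at h2 h3 h4 ⊢
  rw [abs_lt] at h1
  constructor <;> linarith [h1.1, h1.2, h2.1, h2.2, h3.1, h3.2, h4.1, h4.2]

theorem abs_natFloor_mul_div_sub_le {n : ℕ} (hn : 0 < n) {ξ : ℝ} (hξ : 0 < ξ) (c μ : ℝ) {s T : ℝ}
    (hs0 : 0 ≤ s) (hsT : s ≤ T) :
    |(n * ξ)⁻¹ * (⌊s * n⌋₊ * μ) - c * s| ≤ T * |ξ⁻¹ * μ - c| + |c| / n := by
  have hn' : (0 : ℝ) < n := by exact_mod_cast hn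
  set J := ⌊s * n⌋₊ with hJ
  have h1 : (J : ℝ) ≤ s * n := Nat.floor_le (by positivity)
  have h2 : s * n < J + 1 := Nat.lt_floor_add_one _
  have h3 : (J : ℝ) / n ≤ s := (div_le_iff₀ hn').2 h1
  have h4 : |(J : ℝ) / n - s| ≤ 1 / n := by
    rw [abs_sub_comm, abs_of_nonneg (by linarith), sub_le_iff_le_add, ← add_div, le_div_iff₀ hn']
    linarith
  have e : (n * ξ)⁻¹ * (J * μ) - c * s = J / n * (ξ⁻¹ * μ - c) + c * (J / n - s) := by
    field_simp
    ring
  rw [e]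
  refine (abs_add_le _ _).trans (add_le_add ?_ ?_)
  · rw [abs_mul, abs_of_nonneg (by positivity : (0 : ℝ) ≤ J / n)]
    exact mul_le_mul_of_nonneg_right (h3.trans hsT) (abs_nonneg _)
  · rw [abs_mul, div_eq_mul_one_div |c|]
    exact mul_le_mul_of_nonneg_left h4 (abs_nonneg _)

namespace IsMarkovChain

variable {Ω D : Type*} [MeasurableSpace Ω] [MeasurableSpace D] {Ψ : Kernel D D}
  [IsMarkovKernel Ψ] {π : Measure D} {P : Measure Ω} [IsProbabilityMeasure P] {Z : ℕ → Ω → D}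
  {ψ : Measure D} [IsProbabilityMeasure ψ]

/-- Non-asymptotic form of the law of large numbers, on an event that gives `Z k₀` a law dominated
by `L • ψ`: the first `k₀` terms are treated separately, the others by the maximal inequality. -/
theorem measure_le_iSup_scaledSum_le (hZ : IsMarkovChain Ψ π P Z) (hψ : Kernel.Invariant Ψ ψ)
    {A : ℝ} (hA : HasPoissonBound Ψ ψ A) {k₀ : ℕ} {B : Set D} (hB : MeasurableSet B)
    {L : NNReal} (hL : (P.restrict (Z k₀ ⁻¹' B)).map (Z k₀) ≤ (L : ℝ≥0∞) • ψ)
    {h : ℕ → D → ℝ} {ξ : ℕ → ℝ} {n : ℕ} (hn : 0 < n) (hξ : 0 < ξ n) (hh : Measurable (h n))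
    (hint : ∀ x, Integrable (h n) (Ψ x)) (hh2 : MemLp (h n) 2 ψ)
    {C : ℝ} (hC : ∀ x, |∫ y, h n y ∂(Ψ x)| ≤ C) {c T δ ε : ℝ} (hδ : 0 < δ)
    (hε0 : 0 < ε) (hε : (k₀ + 1) * δ + (n * ξ n)⁻¹ * (k₀ * C + 2 * (A * (2 * C)))
      + (T * |(ξ n)⁻¹ * ∫ y, h n y ∂ψ - c| + |c| / n) < ε) :
    P.restrict (Z k₀ ⁻¹' B) {ω | ENNReal.ofReal ε ≤ ⨆ s ∈ Set.Icc (0 : ℝ) T,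
        ENNReal.ofReal |scaledSum h ξ Z n s ω - c * s|}
      ≤ ∑ k ∈ Finset.Icc 1 k₀, P.restrict (Z k₀ ⁻¹' B) {ω | δ * (n * ξ n) ≤ |h n (Z k ω)|}
        + ENNReal.ofReal (⌊T * n⌋₊ * (L * (4 * ∫ x, h n x ^ 2 ∂ψ
          + (4 * C + 8 * (A * (2 * C))) * ∫ x, |h n x| ∂ψ)) / (δ * (n * ξ n)) ^ 2) := by
  have hn' : (0 : ℝ) < n := by exact_mod_cast hn
  have hnξ : 0 < n * ξ n := mul_pos hn' hξ
  set μ := ∫ y, h n y ∂ψ with hμ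
  have hh1 : Integrable (h n) ψ := hh2.integrable one_le_two
  have hTm := measurable_integral_kernel (κ := Ψ) hh
  have hTi : Integrable (fun x => ∫ y, h n y ∂(Ψ x)) ψ :=
    integrable_integral_of_integrable_bind (by rwa [hψ.def])
  have hTμ : ∫ x, ∫ y, h n y ∂(Ψ x) ∂ψ = μ := hψ.integral_integral hh1
  have hμC : |μ| ≤ C := by
    rw [← hTμ]
    have := norm_integral_le_of_norm_le_const (μ := ψ)
      (f := fun x => ∫ y, h n y ∂(Ψ x)) (C := C) (ae_of_all _ hC)
    simpa using this
  obtain ⟨F, hF, hK, hP⟩ := hA (fun x => ∫ y, h n y ∂(Ψ x) - μ) (2 * C) (hTm.sub_const μ)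
    (fun x => (abs_sub _ _).trans (by linarith [hC x]))
    (by rw [integral_sub hTi (integrable_const _), hTμ]; simp)
  set K := A * (2 * C) with hKdef
  obtain ⟨hu2, hvar⟩ := memLp_poisson_increment hψ hh hC hh2 hF hK hP
  have hum : Measurable fun p : D × D => h n p.2 + F p.2 - F p.1 - μ :=
    (((hh.comp measurable_snd).add (hF.comp measurable_snd)).sub
      (hF.comp measurable_fst)).sub_const μ
  have hFI : ∀ x, Integrable F (Ψ x) := fun x =>
    Integrable.of_bound hF.aestronglyMeasurable K (ae_of_all _ hK)
  have hu0 : ∀ x, ∫ y, (h n y + F y - F x - μ) ∂(Ψ x) = 0 := by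
    intro x
    have i1 : Integrable (fun y => h n y + F y) (Ψ x) := (hint x).add (hFI x)
    have i2 : Integrable (fun y => h n y + F y - F x) (Ψ x) := i1.sub (integrable_const _)
    rw [integral_sub i2 (integrable_const _), integral_sub i1 (integrable_const _),
      integral_add (hint x) (hFI x)]
    have := hP x
    simp only [integral_const, probReal_univ, one_smul]
    linarith
  have hmax := hZ.measure_exists_le_abs_sum_le hψ hB hL hum hu2 hu0 (mul_pos hδ hnξ) ⌊T * n⌋₊
  set Q := P.restrict (Z k₀ ⁻¹' B) with hQ
  have hsub : {ω | ENNReal.ofReal ε ≤ ⨆ s ∈ Set.Icc (0 : ℝ) T,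
        ENNReal.ofReal |scaledSum h ξ Z n s ω - c * s|} ⊆
      (⋃ k ∈ Finset.Icc 1 k₀, {ω | δ * (n * ξ n) ≤ |h n (Z k ω)|}) ∪
      {ω | ∃ j ≤ ⌊T * n⌋₊, δ * (n * ξ n) ≤ |∑ i ∈ Finset.range j,
        (h n (Z (k₀ + i + 1) ω) + F (Z (k₀ + i + 1) ω) - F (Z (k₀ + i) ω) - μ)|} := by
    intro ω hω
    by_contra hcon
    simp only [Set.mem_union, Set.mem_iUnion, Set.mem_ofPred_eq, not_or, not_exists, not_and,
      not_le] at hcon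
    obtain ⟨h1, h2⟩ := hcon
    have hb : ∀ s ∈ Set.Icc (0 : ℝ) T, |scaledSum h ξ Z n s ω - c * s| ≤
        (k₀ + 1) * δ + (n * ξ n)⁻¹ * (k₀ * C + 2 * K)
          + (T * |(ξ n)⁻¹ * μ - c| + |c| / n) := by
      intro s hs
      have b1 := abs_sum_sub_le_of_forall_abs_sum_lt hK μ (fun k => Z k ω)
        (mul_pos hδ hnξ).le (fun k hk => (h1 k hk).le) h2
        (Nat.floor_mono (mul_le_mul_of_nonneg_right hs.2 hn'.le))
      have b2 := abs_natFloor_mul_div_sub_le hn hξ c μ hs.1 hs.2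
      have e : scaledSum h ξ Z n s ω - c * s
          = (n * ξ n)⁻¹ * (∑ k ∈ Finset.Icc 1 ⌊s * n⌋₊, h n (Z k ω) - ⌊s * n⌋₊ * μ)
            + ((n * ξ n)⁻¹ * (⌊s * n⌋₊ * μ) - c * s) := by
        rw [scaledSum]
        ring
      rw [e]
      refine (abs_add_le _ _).trans (add_le_add ?_ b2)
      rw [abs_mul, abs_of_pos (inv_pos.2 hnξ)]
      calc (n * ξ n)⁻¹ * |∑ k ∈ Finset.Icc 1 ⌊s * n⌋₊, h n (Z k ω) - ⌊s * n⌋₊ * μ|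
          ≤ (n * ξ n)⁻¹ * (k₀ * (δ * (n * ξ n)) + δ * (n * ξ n) + (k₀ * C + 2 * K)) := by
            refine mul_le_mul_of_nonneg_left (b1.trans ?_) (inv_pos.2 hnξ).le
            gcongr
        _ = (k₀ + 1) * δ + (n * ξ n)⁻¹ * (k₀ * C + 2 * K) := by
            have hne : n * ξ n ≠ 0 := hnξ.ne'
            field_simp
    have hle : (⨆ s ∈ Set.Icc (0 : ℝ) T, ENNReal.ofReal |scaledSum h ξ Z n s ω - c * s|) ≤
        ENNReal.ofReal ((k₀ + 1) * δ + (n * ξ n)⁻¹ * (k₀ * C + 2 * K)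
          + (T * |(ξ n)⁻¹ * μ - c| + |c| / n)) :=
      iSup₂_le fun s hs => ENNReal.ofReal_le_ofReal (hb s hs)
    exact absurd (le_trans hω hle) (not_le.2 ((ENNReal.ofReal_lt_ofReal_iff hε0).2 hε))
  refine (measure_mono hsub).trans ((measure_union_le _ _).trans (add_le_add
    (measure_biUnion_finset_le _ _) (hmax.trans (ENNReal.ofReal_le_ofReal ?_))))
  gcongr

end IsMarkovChain

/-- The part of a finite measure that is dominated by a multiple of `ψ` exhausts the measure up to
a `ψ`-null set that carries the singular part. -/
theorem exists_null_forall_exists_restrict_le {D : Type*} [MeasurableSpace D] (μ ψ : Measure D)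
    [IsFiniteMeasure μ] [IsFiniteMeasure ψ] :
    ∃ N, MeasurableSet N ∧ ψ N = 0 ∧ ∀ η : ℝ≥0∞, 0 < η → ∃ (L : NNReal) (B : Set D),
      MeasurableSet B ∧ μ.restrict B ≤ (L : ℝ≥0∞) • ψ ∧ μ Bᶜ ≤ μ N + η := by
  obtain ⟨S, hS, hS1, hS2⟩ := Measure.mutuallySingular_singularPart μ ψ
  set r := μ.rnDeriv ψ with hr
  have hrm : Measurable r := Measure.measurable_rnDeriv μ ψ
  -- on `S` the measure has the finite density `r`, which is truncated at a large level
  have hdec : μ = μ.singularPart ψ + ψ.withDensity r := Measure.haveLebesgueDecomposition_add μ ψ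
  have hWfin : IsFiniteMeasure (ψ.withDensity r) :=
    isFiniteMeasure_of_le μ (Measure.withDensity_rnDeriv_le μ ψ)
  have hlim : Tendsto (fun n : ℕ => ψ.withDensity r {x | (n : ℝ≥0∞) < r x}) atTop (𝓝 0) := by
    have h1 := tendsto_measure_iInter_atTop (μ := ψ.withDensity r)
      (s := fun n : ℕ => {x | (n : ℝ≥0∞) < r x})
      (fun n => (measurableSet_lt measurable_const hrm).nullMeasurableSet)
      (fun m n hmn x hx => lt_of_le_of_lt (by exact_mod_cast hmn) (show (n : ℝ≥0∞) < r x from hx))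
      ⟨0, measure_ne_top _ _⟩
    have h2 : ψ.withDensity r (⋂ n : ℕ, {x | (n : ℝ≥0∞) < r x}) = 0 := by
      refine withDensity_absolutelyContinuous ψ r (measure_mono_null (fun x hx => ?_)
        (ae_iff.1 (Measure.rnDeriv_lt_top μ ψ)))
      rw [Set.mem_iInter] at hx
      intro hlt
      obtain ⟨n, hn⟩ := ENNReal.exists_nat_gt hlt.ne
      exact lt_asymm hn (hx n)
    rwa [h2] at h1
  refine ⟨Sᶜ, hS.compl, hS2, fun η hη => ?_⟩
  obtain ⟨n, hn⟩ := (ENNReal.tendsto_nhds_zero.1 hlim η hη).exists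
  have hBm : MeasurableSet {x | r x ≤ (n : ℝ≥0∞)} := measurableSet_le hrm measurable_const
  refine ⟨n, S ∩ {x | r x ≤ (n : ℝ≥0∞)}, hS.inter hBm, Measure.le_iff.2 fun E hE => ?_, ?_⟩
  · have hE' := hE.inter (hS.inter hBm)
    rw [Measure.restrict_apply hE, hdec, Measure.add_apply, withDensity_apply _ hE',
      measure_mono_null (fun x hx => hx.2.1) hS1, zero_add]
    calc ∫⁻ x in E ∩ (S ∩ {x | r x ≤ (n : ℝ≥0∞)}), r x ∂ψ
        ≤ ∫⁻ _ in E ∩ (S ∩ {x | r x ≤ (n : ℝ≥0∞)}), (n : ℝ≥0∞) ∂ψ :=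
          setLIntegral_mono' hE' fun x hx => hx.2.2
      _ = n * ψ (E ∩ (S ∩ {x | r x ≤ (n : ℝ≥0∞)})) := setLIntegral_const _ _
      _ ≤ n * ψ E := by gcongr; exact Set.inter_subset_left
      _ = _ := by simp
  · have hsub : (S ∩ {x | r x ≤ (n : ℝ≥0∞)})ᶜ ⊆ Sᶜ ∪ (S ∩ {x | (n : ℝ≥0∞) < r x}) := by
      intro x hx
      by_cases hxS : x ∈ S
      · exact Or.inr ⟨hxS, not_le.1 fun hle : r x ≤ n => hx ⟨hxS, hle⟩⟩
      · exact Or.inl hxS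
    refine (measure_mono hsub).trans ((measure_union_le _ _).trans (add_le_add le_rfl ?_))
    conv_lhs => rw [hdec]
    rw [Measure.add_apply, measure_mono_null Set.inter_subset_left hS1, zero_add]
    exact (measure_mono Set.inter_subset_right).trans hn

/-! ### Limits, and arbitrary initial laws -/

namespace IsMarkovChain

variable {Ω D : Type*} [MeasurableSpace Ω] [MeasurableSpace D] {Ψ : Kernel D D}
  [IsMarkovKernel Ψ] {π : Measure D} {P : Measure Ω} [IsProbabilityMeasure P] {Z : ℕ → Ω → D}
  {ψ : Measure D}

/-- The expected total time that the chain spends in a `ψ`-null set is finite, whatever its initial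
law: the indicator of the set is of the form `F - Ψ F` with `F` bounded. -/
theorem tendsto_map_apply_of_null (hZ : IsMarkovChain Ψ π P Z) {A : ℝ}
    (hA : HasPoissonBound Ψ ψ A) {N : Set D} (hN : MeasurableSet N) (hN0 : ψ N = 0) :
    Tendsto (fun k => P.map (Z k) N) atTop (𝓝 0) := by
  have hprob : ∀ k, IsProbabilityMeasure (P.map (Z k)) := fun k =>
    Measure.isProbabilityMeasure_map (hZ.measurable k).aemeasurable
  obtain ⟨F, hF, hK, hP⟩ := hA (N.indicator 1) 1 (measurable_one.indicator hN)
    (fun x => by by_cases hx : x ∈ N <;> simp [hx])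
    (by rw [integral_indicator_one hN, measureReal_def, hN0, ENNReal.toReal_zero])
  rw [mul_one] at hK
  have hFI : ∀ (μ : Measure D) [IsFiniteMeasure μ], Integrable F μ := fun μ _ =>
    Integrable.of_bound hF.aestronglyMeasurable A (ae_of_all _ hK)
  have hFA : ∀ k, |∫ x, F x ∂(P.map (Z k))| ≤ A := fun k => by
    have := norm_integral_le_of_norm_le_const (μ := P.map (Z k)) (f := F) (C := A)
      (ae_of_all _ hK)
    simpa using this
  have hstep : ∀ k, (P.map (Z k)).real N
      = ∫ x, F x ∂(P.map (Z k)) - ∫ x, F x ∂(P.map (Z (k + 1))) := by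
    intro k
    have hb : Integrable F ((P.map (Z k)).bind Ψ) := by
      rw [← hZ.map_succ k]
      exact hFI _
    rw [hZ.map_succ k, integral_bind_kernel hb,
      ← integral_sub (hFI _) (integrable_integral_of_integrable_bind hb)]
    simp_rw [hP]
    exact (integral_indicator_one hN).symm
  have hsum : Summable fun k => (P.map (Z k)).real N := by
    refine summable_of_sum_range_le (c := 2 * A) (fun k => measureReal_nonneg) fun m => ?_
    rw [Finset.sum_congr rfl fun k _ => hstep k, Finset.sum_range_sub']
    linarith [(abs_le.1 (hFA 0)).2, (abs_le.1 (hFA m)).1]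
  have h0 := (ENNReal.tendsto_ofReal hsum.tendsto_atTop_zero)
  simpa using h0

/-- The single terms of the additive functional are asymptotically negligible if `Ψ |h n|` is
bounded in `n` at each point. -/
theorem tendsto_measure_le_abs (hZ : IsMarkovChain Ψ π P Z) {h : ℕ → D → ℝ}
    (hmeas : ∀ n, 1 ≤ n → Measurable (h n)) (hint : ∀ n, 1 ≤ n → ∀ x, Integrable (h n) (Ψ x))
    (hbdd : ∀ x, ∃ C : ℝ, ∀ n, 1 ≤ n → ∫ z, |h n z| ∂(Ψ x) ≤ C)
    {b : ℕ → ℝ} (hb : Tendsto b atTop atTop) (k : ℕ) :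
    Tendsto (fun n => P {ω | b n ≤ |h n (Z (k + 1) ω)|}) atTop (𝓝 0) := by
  have hprob : IsProbabilityMeasure (P.map (Z k)) :=
    Measure.isProbabilityMeasure_map (hZ.measurable k).aemeasurable
  have hset : ∀ n, 1 ≤ n → MeasurableSet {x | b n ≤ |h n x|} := fun n hn =>
    measurableSet_le measurable_const (hmeas n hn).abs
  have heq : ∀ᶠ n in atTop, ∫⁻ x, Ψ x {y | b n ≤ |h n y|} ∂(P.map (Z k))
      = P {ω | b n ≤ |h n (Z (k + 1) ω)|} := by
    filter_upwards [eventually_ge_atTop 1] with n hn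
    rw [← Measure.bind_apply (hset n hn) Ψ.aemeasurable, ← hZ.map_succ k,
      Measure.map_apply (hZ.measurable (k + 1)) (hset n hn)]
    rfl
  refine Tendsto.congr' heq ?_
  have h0 := tendsto_lintegral_filter_of_dominated_convergence (μ := P.map (Z k)) (l := atTop)
    (F := fun n x => Ψ x {y | b n ≤ |h n y|}) (f := fun _ => 0) (fun _ => 1)
    ?_ (Eventually.of_forall fun n => ae_of_all _ fun x => prob_le_one) (by simp)
    (ae_of_all _ fun x => ?_)
  · simpa using h0
  · filter_upwards [eventually_ge_atTop 1] with n hn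
    exact Ψ.measurable_coe (hset n hn)
  · obtain ⟨C, hC⟩ := hbdd x
    have hlim : Tendsto (fun n => ENNReal.ofReal (C / b n)) atTop (𝓝 0) := by
      simpa using ENNReal.tendsto_ofReal (tendsto_const_nhds.div_atTop hb)
    refine tendsto_of_tendsto_of_tendsto_of_le_of_le' tendsto_const_nhds hlim
      (Eventually.of_forall fun _ => zero_le) ?_
    filter_upwards [eventually_ge_atTop 1, hb.eventually_gt_atTop 0] with n hn hbn
    rw [← ofReal_measureReal]
    refine ENNReal.ofReal_le_ofReal ((le_div_iff₀ hbn).2 ?_)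
    rw [mul_comm]
    exact (mul_meas_ge_le_integral_of_nonneg (ae_of_all _ fun y => abs_nonneg _)
      (hint n hn x).abs _).trans (hC n hn)

end IsMarkovChain

/-- A ratio whose limit in `[0, ∞]` is `0`, read in `ℝ`. -/
theorem tendsto_integral_div_of_tendsto_lintegral_div {D : Type*} [MeasurableSpace D]
    {ψ : Measure D} {f : ℕ → D → ℝ} (hf : ∀ n, 1 ≤ n → Measurable (f n)) (hf0 : ∀ n x, 0 ≤ f n x)
    {a : ℕ → ℝ} (ha : ∀ n, 1 ≤ n → 0 < a n)
    (h : Tendsto (fun n => (∫⁻ z, ENNReal.ofReal (f n z) ∂ψ) / ENNReal.ofReal (a n)) atTop (𝓝 0)) :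
    (∀ᶠ n in atTop, Integrable (f n) ψ) ∧
      Tendsto (fun n => (∫ z, f n z ∂ψ) / a n) atTop (𝓝 0) := by
  constructor
  · filter_upwards [eventually_ge_atTop 1, h.eventually_lt_const ENNReal.zero_lt_top] with n hn hlt
    refine ⟨(hf n hn).aestronglyMeasurable, ?_⟩
    rw [hasFiniteIntegral_iff_ofReal (ae_of_all _ (hf0 n)), lt_top_iff_ne_top]
    intro htop
    rw [htop, ENNReal.top_div_of_ne_top ENNReal.ofReal_ne_top] at hlt
    exact lt_irrefl _ hlt
  · have h1 := (ENNReal.tendsto_toReal ENNReal.zero_ne_top).comp h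
    rw [ENNReal.toReal_zero] at h1
    refine h1.congr' ?_
    filter_upwards [eventually_ge_atTop 1] with n hn
    rw [Function.comp_apply, ENNReal.toReal_div, ENNReal.toReal_ofReal (ha n hn).le,
      integral_eq_lintegral_of_nonneg_ae (ae_of_all _ (hf0 n)) (hf n hn).aestronglyMeasurable]

namespace IsMarkovChain

variable {Ω D : Type*} [MeasurableSpace Ω] [MeasurableSpace D] {Ψ : Kernel D D}
  [IsMarkovKernel Ψ] {π : Measure D} {P : Measure Ω} [IsProbabilityMeasure P] {Z : ℕ → Ω → D}
  {ψ : Measure D} [IsProbabilityMeasure ψ]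

/-- The law of large numbers holds as soon as, up to an event of small probability, the law of the
chain at some time `k₀` is dominated by a multiple of the invariant probability, and the terms up to
that time are negligible. -/
theorem tendstoUCP_of_forall_exists_restrict (hZ : IsMarkovChain Ψ π P Z)
    (hψ : Kernel.Invariant Ψ ψ) {A : ℝ} (hA : HasPoissonBound Ψ ψ A)
    {h : ℕ → D → ℝ} (hmeas : ∀ n, 1 ≤ n → Measurable (h n))
    (hint : ∀ n, 1 ≤ n → ∀ x, Integrable (h n) (Ψ x))
    {C : ℝ} (hC : ∀ n, 1 ≤ n → ∀ x, |∫ z, h n z ∂(Ψ x)| ≤ C)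
    {ξ : ℕ → ℝ} (hξ : ∀ n, 1 ≤ n → 0 < ξ n) {c : ℝ}
    (hnξ : Tendsto (fun n : ℕ => n * ξ n) atTop atTop)
    (hmean : Tendsto (fun n : ℕ => (ξ n)⁻¹ * ∫ z, h n z ∂ψ) atTop (𝓝 c))
    (habs : Tendsto (fun n : ℕ => (∫⁻ z, ENNReal.ofReal |h n z| ∂ψ)
      / ENNReal.ofReal (n * ξ n ^ 2)) atTop (𝓝 0))
    (hsq : Tendsto (fun n : ℕ => (∫⁻ z, ENNReal.ofReal (h n z ^ 2) ∂ψ)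
      / ENNReal.ofReal (n * ξ n ^ 2)) atTop (𝓝 0))
    (hdom : ∀ η : ℝ≥0∞, 0 < η → ∃ (k₀ : ℕ) (B : Set D) (L : NNReal), MeasurableSet B ∧
      (P.restrict (Z k₀ ⁻¹' B)).map (Z k₀) ≤ (L : ℝ≥0∞) • ψ ∧ P (Z k₀ ⁻¹' B)ᶜ ≤ η ∧
      ∀ k ∈ Finset.Icc 1 k₀, ∀ δ : ℝ, 0 < δ → Tendsto (fun n =>
        P.restrict (Z k₀ ⁻¹' B) {ω | δ * (n * ξ n) ≤ |h n (Z k ω)|}) atTop (𝓝 0)) :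
    TendstoUCP P (scaledSum h ξ Z) (fun s => c * s) := by
  intro T hT ε hε
  have hpos : ∀ n : ℕ, 1 ≤ n → 0 < n * ξ n ^ 2 := fun n hn =>
    mul_pos (by exact_mod_cast hn) (pow_pos (hξ n hn) 2)
  obtain ⟨-, habs'⟩ := tendsto_integral_div_of_tendsto_lintegral_div
    (fun n hn => (hmeas n hn).abs) (fun n x => abs_nonneg _) hpos habs
  obtain ⟨hsqI, hsq'⟩ := tendsto_integral_div_of_tendsto_lintegral_div
    (fun n hn => (hmeas n hn).pow_const 2) (fun n x => sq_nonneg _) hpos hsq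
  rw [ENNReal.tendsto_nhds_zero]
  intro η hη
  have hη2 : 0 < η / 2 := ENNReal.half_pos hη.ne'
  obtain ⟨k₀, B, L, hB, hL, hBη, hinit⟩ := hdom (η / 2) hη2
  -- each of the first `k₀` terms, and the martingale, may contribute `δ`: half of `ε` in total
  set δ := ε / (2 * (k₀ + 1)) with hδdef
  have hδ : 0 < δ := by positivity
  have hδε : (k₀ + 1) * δ = ε / 2 := by
    rw [hδdef]
    field_simp
  have hinv : Tendsto (fun n : ℕ => (n * ξ n)⁻¹) atTop (𝓝 0) := hnξ.inv_tendsto_atTop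
  -- the boundary terms, and the error in the mean
  have hdet : ∀ᶠ n : ℕ in atTop, (k₀ + 1) * δ + (n * ξ n)⁻¹ * (k₀ * C + 2 * (A * (2 * C)))
      + (T * |(ξ n)⁻¹ * ∫ y, h n y ∂ψ - c| + |c| / n) < ε := by
    have h1 : Tendsto (fun n : ℕ => (k₀ + 1) * δ
        + (n * ξ n)⁻¹ * (k₀ * C + 2 * (A * (2 * C)))
        + (T * |(ξ n)⁻¹ * ∫ y, h n y ∂ψ - c| + |c| / n)) atTop
        (𝓝 ((k₀ + 1) * δ + 0 * (k₀ * C + 2 * (A * (2 * C))) + (T * |c - c| + 0))) :=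
      (tendsto_const_nhds.add (hinv.mul_const _)).add
        (((hmean.sub_const c).abs.const_mul T).add
          (tendsto_const_nhds.div_atTop tendsto_natCast_atTop_atTop))
    refine h1.eventually_lt_const ?_
    rw [hδε]
    simp
    linarith
  -- the martingale part, of variance at most `V n` per step
  set V : ℕ → ℝ := fun n => 4 * ∫ x, h n x ^ 2 ∂ψ
    + (4 * C + 8 * (A * (2 * C))) * ∫ x, |h n x| ∂ψ with hV
  have hVlim : Tendsto (fun n : ℕ => V n / (n * ξ n ^ 2)) atTop (𝓝 0) := by
    have h1 := (hsq'.const_mul 4).add (habs'.const_mul (4 * C + 8 * (A * (2 * C))))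
    rw [mul_zero, mul_zero, add_zero] at h1
    refine h1.congr fun n => ?_
    rw [hV]
    ring
  have hmart : Tendsto (fun n : ℕ =>
      ENNReal.ofReal (⌊T * n⌋₊ * (L * V n) / (δ * (n * ξ n)) ^ 2)) atTop (𝓝 0) := by
    have h1 : Tendsto (fun n : ℕ => T * L / δ ^ 2 * |V n / (n * ξ n ^ 2)|) atTop (𝓝 0) := by
      simpa using hVlim.abs.const_mul (T * L / δ ^ 2)
    have h2 := ENNReal.tendsto_ofReal h1
    rw [ENNReal.ofReal_zero] at h2
    refine tendsto_of_tendsto_of_tendsto_of_le_of_le' tendsto_const_nhds h2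
      (Eventually.of_forall fun _ => zero_le) ?_
    filter_upwards [eventually_ge_atTop 1] with n hn
    have hn' : (0 : ℝ) < n := by exact_mod_cast hn
    have hξn := hξ n hn
    refine ENNReal.ofReal_le_ofReal ?_
    have hfl : (⌊T * n⌋₊ : ℝ) ≤ T * n := Nat.floor_le (by positivity)
    calc ⌊T * n⌋₊ * (L * V n) / (δ * (n * ξ n)) ^ 2
        ≤ T * n * (L * |V n|) / (δ * (n * ξ n)) ^ 2 := by
          have hV' : L * V n ≤ L * |V n| :=
            mul_le_mul_of_nonneg_left (le_abs_self _) L.coe_nonneg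
          have hV0 : 0 ≤ L * |V n| := mul_nonneg L.coe_nonneg (abs_nonneg _)
          refine div_le_div_of_nonneg_right ?_ (sq_nonneg _)
          exact (mul_le_mul_of_nonneg_left hV' (Nat.cast_nonneg _)).trans
            (mul_le_mul_of_nonneg_right hfl hV0)
      _ = T * L / δ ^ 2 * |V n / (n * ξ n ^ 2)| := by
          rw [abs_div, abs_of_pos (hpos n hn)]
          field_simp
  have hsum : Tendsto (fun n : ℕ => ∑ k ∈ Finset.Icc 1 k₀,
      P.restrict (Z k₀ ⁻¹' B) {ω | δ * (n * ξ n) ≤ |h n (Z k ω)|}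
      + ENNReal.ofReal (⌊T * n⌋₊ * (L * V n) / (δ * (n * ξ n)) ^ 2)) atTop (𝓝 0) := by
    have h1 := (tendsto_finsetSum (Finset.Icc 1 k₀) fun k hk => hinit k hk δ hδ).add hmart
    simpa using h1
  filter_upwards [eventually_ge_atTop 1, hdet, hsqI, ENNReal.tendsto_nhds_zero.1 hsum _ hη2]
    with n hn hdn hsqn hsn
  have hh2 : MemLp (h n) 2 ψ :=
    (memLp_two_iff_integrable_sq (hmeas n hn).aestronglyMeasurable).2 hsqn
  have hmain := hZ.measure_le_iSup_scaledSum_le hψ hA hB hL hn (hξ n hn) (hmeas n hn) (hint n hn)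
    hh2 (hC n hn) (c := c) (T := T) hδ hε hdn
  refine (measure_le_inter_add_sdiff P _ (Z k₀ ⁻¹' B)).trans ?_
  rw [← Measure.restrict_apply' (hZ.measurable k₀ hB), ← ENNReal.add_halves η]
  exact add_le_add (hmain.trans hsn) ((measure_mono fun ω hω => hω.2).trans hBη)

end IsMarkovChain

theorem IsMarkovChain.map_restrict_preimage {Ω D : Type*} [MeasurableSpace Ω] [MeasurableSpace D]
    {Ψ : Kernel D D} {π : Measure D} {P : Measure Ω} {Z : ℕ → Ω → D}
    (hZ : IsMarkovChain Ψ π P Z) (k : ℕ) {B : Set D} (hB : MeasurableSet B) :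
    (P.restrict (Z k ⁻¹' B)).map (Z k) = (P.map (Z k)).restrict B :=
  (Measure.restrict_map (hZ.measurable k) hB).symm

theorem tendsto_measure_le_abs_of_tendsto_lintegral_sq {D : Type*} [MeasurableSpace D]
    {ψ : Measure D} {h : ℕ → D → ℝ} (hmeas : ∀ n, 1 ≤ n → Measurable (h n))
    {ξ : ℕ → ℝ} (hξ : ∀ n, 1 ≤ n → 0 < ξ n)
    (hsq : Tendsto (fun n : ℕ => (∫⁻ z, ENNReal.ofReal (h n z ^ 2) ∂ψ)
      / ENNReal.ofReal (n * ξ n ^ 2)) atTop (𝓝 0)) {δ : ℝ} (hδ : 0 < δ) :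
    Tendsto (fun n : ℕ => ψ {x | δ * (n * ξ n) ≤ |h n x|}) atTop (𝓝 0) := by
  have h1 : Tendsto (fun n : ℕ => (∫⁻ z, ENNReal.ofReal (h n z ^ 2) ∂ψ)
      / ENNReal.ofReal (n * ξ n ^ 2) / ENNReal.ofReal (δ ^ 2)) atTop (𝓝 0) := by
    have := ENNReal.Tendsto.div_const hsq (b := ENNReal.ofReal (δ ^ 2))
      (Or.inr (by simpa using hδ.ne'))
    rwa [ENNReal.zero_div] at this
  refine tendsto_of_tendsto_of_tendsto_of_le_of_le' tendsto_const_nhds h1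
    (Eventually.of_forall fun _ => zero_le) ?_
  filter_upwards [eventually_ge_atTop 1] with n hn
  have hn1 : (1 : ℝ) ≤ n := by exact_mod_cast hn
  have hn0 : (0 : ℝ) < n := by linarith
  have hξn := hξ n hn
  have hδ2 : ENNReal.ofReal (δ ^ 2) ≠ 0 := by simpa using hδ.ne'
  have hnn : ENNReal.ofReal (n * ξ n ^ 2) ≠ 0 := by
    rw [Ne, ENNReal.ofReal_eq_zero, not_le]
    positivity
  rw [ENNReal.le_div_iff_mul_le (Or.inl hδ2) (Or.inl ENNReal.ofReal_ne_top),
    ENNReal.le_div_iff_mul_le (Or.inl hnn) (Or.inl ENNReal.ofReal_ne_top), mul_assoc,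
    ← ENNReal.ofReal_mul (by positivity), mul_comm]
  refine le_trans (mul_le_mul_right (measure_mono fun x hx => ?_) _)
    (mul_meas_ge_le_lintegral₀ ((hmeas n hn).pow_const 2).ennreal_ofReal.aemeasurable
      (ENNReal.ofReal (δ ^ 2 * (n * ξ n ^ 2))))
  refine ENNReal.ofReal_le_ofReal ?_
  have hx' : δ * (n * ξ n) ≤ |h n x| := hx
  calc δ ^ 2 * (n * ξ n ^ 2) ≤ δ ^ 2 * (n * ξ n ^ 2) * n :=
        le_mul_of_one_le_right (by positivity) hn1
    _ = (δ * (n * ξ n)) ^ 2 := by ring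
    _ ≤ |h n x| ^ 2 := pow_le_pow_left₀ (by positivity) hx' 2
    _ = h n x ^ 2 := sq_abs _

theorem theorem4p2
    {D : Type*} [MeasurableSpace D]
    (Ψ : Kernel D D) [IsMarkovKernel Ψ]
    (ψ : Measure D) [IsProbabilityMeasure ψ] (hψ : Kernel.Invariant Ψ ψ)
    (hpetite : IsPetiteSpace Ψ)
    (h : ℕ → D → ℝ) (hmeas : ∀ n, 1 ≤ n → Measurable (h n))
    -- `Ψ h_n` is well defined and uniformly bounded
    (hint : ∀ n, 1 ≤ n → ∀ x, Integrable (h n) (Ψ x))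
    (hbdd : ∃ C : ℝ, ∀ n, 1 ≤ n → ∀ x, |∫ z, h n z ∂(Ψ x)| ≤ C)
    (ξ : ℕ → ℝ) (hξ : ∀ n, 1 ≤ n → 0 < ξ n)
    (c : ℝ)
    (hnξ : Tendsto (fun n : ℕ => n * ξ n) atTop atTop)
    (hmean : Tendsto (fun n : ℕ => (ξ n)⁻¹ * ∫ z, h n z ∂ψ) atTop (𝓝 c))
    -- the next two are limits in `[0, ∞]`: they contain that `h_n` is eventually in `L²(ψ)`
    (habs : Tendsto (fun n : ℕ => (∫⁻ z, ENNReal.ofReal |h n z| ∂ψ)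
      / ENNReal.ofReal (n * ξ n ^ 2)) atTop (𝓝 0))
    (hsq : Tendsto (fun n : ℕ => (∫⁻ z, ENNReal.ofReal (h n z ^ 2) ∂ψ)
      / ENNReal.ofReal (n * ξ n ^ 2)) atTop (𝓝 0))
    -- the chain, under an arbitrary initial law `π`
    {Ω : Type*} [MeasurableSpace Ω] (P : Measure Ω) [IsProbabilityMeasure P]
    (π : Measure D) [IsProbabilityMeasure π]
    (Z : ℕ → Ω → D) (hZ : IsMarkovChain Ψ π P Z) :
    -- every initial law whose image under `Ψ` is absolutely continuous (for instance `π = ψ`)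
    (π.bind Ψ ≪ ψ → TendstoUCP P (scaledSum h ξ Z) (fun s => c * s)) ∧
    -- every initial law, if `Ψ |h_n|` is bounded in `n` at each point
    ((∀ x, ∃ C : ℝ, ∀ n, 1 ≤ n → ∫ z, |h n z| ∂(Ψ x) ≤ C) →
      TendstoUCP P (scaledSum h ξ Z) (fun s => c * s)) := by
  obtain ⟨A, hA⟩ := hpetite.exists_hasPoissonBound hψ
  obtain ⟨C, hC⟩ := hbdd
  have hlaw : ∀ k, IsProbabilityMeasure (P.map (Z k)) := fun k =>
    Measure.isProbabilityMeasure_map (hZ.measurable k).aemeasurable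
  have hcompl : ∀ k B, MeasurableSet B → P (Z k ⁻¹' B)ᶜ = P.map (Z k) Bᶜ := fun k B hB => by
    rw [Measure.map_apply (hZ.measurable k) hB.compl, Set.preimage_compl]
  constructor
  · intro hac
    refine hZ.tendstoUCP_of_forall_exists_restrict hψ hA hmeas hint hC hξ hnξ hmean habs hsq
      fun η hη => ?_
    obtain ⟨N, -, hN0, hdom⟩ := exists_null_forall_exists_restrict_le (P.map (Z 1)) ψ
    obtain ⟨L, B, hB, hL, hBη⟩ := hdom η hη
    have hN1 : P.map (Z 1) N = 0 := by
      have h1 := hZ.map_succ 0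
      rw [hZ.map_zero, zero_add] at h1
      rw [h1]
      exact hac hN0
    rw [← hZ.map_restrict_preimage 1 hB] at hL
    refine ⟨1, B, L, hB, hL, by rwa [hcompl 1 B hB, ← zero_add η, ← hN1], fun k hk δ hδ => ?_⟩
    obtain rfl : k = 1 := by simpa using hk
    have h0 : Tendsto (fun n : ℕ => (L : ℝ≥0∞) * ψ {x | δ * (n * ξ n) ≤ |h n x|}) atTop (𝓝 0) := by
      simpa using ENNReal.Tendsto.const_mul
        (tendsto_measure_le_abs_of_tendsto_lintegral_sq hmeas hξ hsq hδ)
        (Or.inr (ENNReal.coe_ne_top (r := L)))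
    refine tendsto_of_tendsto_of_tendsto_of_le_of_le' tendsto_const_nhds h0
      (Eventually.of_forall fun _ => zero_le) ?_
    filter_upwards [eventually_ge_atTop 1] with n hn
    have h1 := hL {x | δ * (n * ξ n) ≤ |h n x|}
    rwa [Measure.map_apply (hZ.measurable 1)
      (measurableSet_le measurable_const (hmeas n hn).abs)] at h1
  · intro hbdd'
    refine hZ.tendstoUCP_of_forall_exists_restrict hψ hA hmeas hint hC hξ hnξ hmean habs hsq
      fun η hη => ?_
    choose N hN hN0 hdom using fun k => exists_null_forall_exists_restrict_le (P.map (Z k)) ψ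
    have hη2 : 0 < η / 2 := ENNReal.half_pos hη.ne'
    obtain ⟨k₀, hk₀⟩ := (ENNReal.tendsto_nhds_zero.1 (hZ.tendsto_map_apply_of_null hA
      (MeasurableSet.iUnion hN) (measure_iUnion_null hN0)) _ hη2).exists
    obtain ⟨L, B, hB, hL, hBη⟩ := hdom k₀ _ hη2
    rw [← hZ.map_restrict_preimage k₀ hB] at hL
    refine ⟨k₀, B, L, hB, hL, ?_, fun k hk δ hδ => ?_⟩
    · rw [hcompl k₀ B hB, ← ENNReal.add_halves η]
      exact hBη.trans (add_le_add
        ((measure_mono (Set.subset_iUnion N k₀)).trans hk₀) le_rfl)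
    · obtain ⟨j, rfl⟩ := Nat.exists_eq_add_of_le' (Finset.mem_Icc.1 hk).1
      exact tendsto_of_tendsto_of_tendsto_of_le_of_le tendsto_const_nhds
        (hZ.tendsto_measure_le_abs hmeas hint hbdd' (hnξ.const_mul_atTop hδ) j)
        (fun _ => zero_le) fun n => Measure.restrict_apply_le _ _
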